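/- All graphs are finite, simple and undirected. A graph is chordal if every induced cycle has length exactly three; a chordal deletion of a graph $G$ is a set $X$ of vertices such that $G-X$ is chordal; an independent cutset of $G$ is a set $S$ of pairwise nonadjacent vertices such that $G-S$ is disconnected (i.e. has at least two components). Consider as inputs the pairs $(G,\ell)$ where $G$ is a connected graph with $n$ vertices and $\ell$ is the size of some chordal deletion of $G$. For $g:\mathbb{N}\to\mathbb{R}_{\ge 0}$, an algorithm runs in $\mathcal{O}^*(g(\ell))$ time if there are constants $C,c\in\mathbb{N}$ such that on every such input $(G,\ell)$ it halts after at most $C\cdot g(\ell)\cdot n^{c}$ steps. (Time is measured on a unit-cost pointer machine, namely while-programs over binary trees, with $G$ given by its adjacency matrix and $\ell$ in unary.) Let $f:\mathbb{N}\to\mathbb{R}_{\ge 0}$. If there is an algorithm that, on every such input $(G,\ell)$, computes a chordal deletion of $G$ of size $\ell$, in $\mathcal{O}^*(f(\ell))$ time, then there is an algorithm that, on every such input $(G,\ell)$, decides whether $G$ has an independent cutset, in $\mathcal{O}^*(f(\ell)+3^{\ell})$ time. -/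

import Mathlib

/-! ### Graph notions -/

namespace SimpleGraph

/-- A graph is chordal if every induced cycle has length exactly three. -/
def IsChordal {V : Type*} (G : SimpleGraph V) : Prop :=
  ∀ k : ℕ, 3 ≤ k → Nonempty (cycleGraph k ↪g G) → k = 3

/-- `X` is a chordal (vertex-)deletion of `G`: the graph `G - X` is chordal. -/
def IsChordalDeletion {V : Type*} (G : SimpleGraph V) (X : Finset V) : Prop :=
  (G.induce ((X : Set V)ᶜ)).IsChordal

/-- `S` is a cutset of `G`: the graph `G - S` is disconnected, that is, some two of its vertices
are not joined by a path. (The graph without vertices is not disconnected.) -/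
def IsCutset {V : Type*} (G : SimpleGraph V) (S : Finset V) : Prop :=
  ¬ (G.induce ((S : Set V)ᶜ)).Preconnected

/-- `G` has an independent cutset. -/
def HasIndependentCutset {V : Type*} (G : SimpleGraph V) : Prop :=
  ∃ S : Finset V, G.IsIndepSet (S : Set V) ∧ G.IsCutset S

end SimpleGraph

/-! ### The machine model

Programs of a structured while-language over binary trees (S-expressions) with a single variable.
Each elementary operation (creating a cell, following a pointer, testing for `nil`, copying a
pointer, a control-flow step) costs one unit of time. An ordinary random access machine simulates
each operation in constantly many steps, and a run of `T` steps of a random access machine is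
simulated in this model with an overhead of a factor that is polynomial in `log T` (the memory is
kept as a balanced tree), so that factors which are not polynomial, such as `3 ^ ℓ`, are the same
in both models. -/

/-- The data: binary trees, i.e. S-expressions with the single atom `nil`. -/
inductive SExp : Type
  | nil : SExp
  | cons : SExp → SExp → SExp

/-- Programs. A program transforms one S-expression into another one (or does not halt). -/
inductive Prog : Type
  /-- return the input -/
  | id : Prog
  /-- return `nil` -/
  | nil : Prog
  /-- first component of the input -/
  | head : Prog
  /-- second component of the input -/
  | tail : Prog
  /-- run both programs on the input and return the pair of the results -/
  | cons : Prog → Prog → Prog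
  /-- run the first program, then the second one on its result -/
  | seq : Prog → Prog → Prog
  /-- run the first program on the input as a test; continue on the input with the second program
  if the result of the test is not `nil`, and with the third one if it is `nil` -/
  | ite : Prog → Prog → Prog → Prog
  /-- while the test (first program) does not return `nil` on the current value, replace the
  current value by the result of the body (second program) on it -/
  | loop : Prog → Prog → Prog

/-- `Run p x y t`: started on `x`, the program `p` halts with result `y` after exactly `t` steps. -/
inductive Prog.Run : Prog → SExp → SExp → ℕ → Prop
  | id (x : SExp) : Run .id x x 1
  | nil (x : SExp) : Run .nil x .nil 1
  | head_nil : Run .head .nil .nil 1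
  | head_cons (a b : SExp) : Run .head (.cons a b) a 1
  | tail_nil : Run .tail .nil .nil 1
  | tail_cons (a b : SExp) : Run .tail (.cons a b) b 1
  | cons {p q : Prog} {x a b : SExp} {s t : ℕ} :
      Run p x a s → Run q x b t → Run (.cons p q) x (.cons a b) (s + t + 1)
  | seq {p q : Prog} {x y z : SExp} {s t : ℕ} :
      Run p x y s → Run q y z t → Run (.seq p q) x z (s + t + 1)
  | ite_true {c p q : Prog} {x a b y : SExp} {s t : ℕ} :
      Run c x (.cons a b) s → Run p x y t → Run (.ite c p q) x y (s + t + 1)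
  | ite_false {c p q : Prog} {x y : SExp} {s t : ℕ} :
      Run c x .nil s → Run q x y t → Run (.ite c p q) x y (s + t + 1)
  | loop_done {c p : Prog} {x : SExp} {s : ℕ} :
      Run c x .nil s → Run (.loop c p) x x (s + 1)
  | loop_step {c p : Prog} {x a b y z : SExp} {s t u : ℕ} :
      Run c x (.cons a b) s → Run p x y t → Run (.loop c p) y z u →
        Run (.loop c p) x z (s + t + u + 1)

/-- The model is deterministic: result and running time are determined by program and input. -/
theorem Prog.Run.deterministic {p : Prog} {x y : SExp} {s : ℕ} (h : p.Run x y s) :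
    ∀ {z : SExp} {t : ℕ}, p.Run x z t → y = z ∧ s = t := by
  induction h with
  | id | nil | head_nil | head_cons | tail_nil | tail_cons =>
    intro z t h'; cases h'; exact ⟨rfl, rfl⟩
  | cons _ _ ih₁ ih₂ =>
    intro z t h'
    cases h' with
    | cons h₁ h₂ =>
      obtain ⟨rfl, rfl⟩ := ih₁ h₁
      obtain ⟨rfl, rfl⟩ := ih₂ h₂
      exact ⟨rfl, rfl⟩
  | seq _ _ ih₁ ih₂ =>
    intro z t h'
    cases h' with
    | seq h₁ h₂ =>
      obtain ⟨rfl, rfl⟩ := ih₁ h₁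
      obtain ⟨rfl, rfl⟩ := ih₂ h₂
      exact ⟨rfl, rfl⟩
  | ite_true _ _ ih₁ ih₂ =>
    intro z t h'
    cases h' with
    | ite_true h₁ h₂ =>
      obtain ⟨_, rfl⟩ := ih₁ h₁
      obtain ⟨rfl, rfl⟩ := ih₂ h₂
      exact ⟨rfl, rfl⟩
    | ite_false h₁ _ => exact absurd (ih₁ h₁).1 (by simp)
  | ite_false _ _ ih₁ ih₂ =>
    intro z t h'
    cases h' with
    | ite_true h₁ _ => exact absurd (ih₁ h₁).1 (by simp)
    | ite_false h₁ h₂ =>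
      obtain ⟨_, rfl⟩ := ih₁ h₁
      obtain ⟨rfl, rfl⟩ := ih₂ h₂
      exact ⟨rfl, rfl⟩
  | loop_done _ ih₁ =>
    intro z t h'
    cases h' with
    | loop_done h₁ =>
      obtain ⟨_, rfl⟩ := ih₁ h₁
      exact ⟨rfl, rfl⟩
    | loop_step h₁ _ _ => exact absurd (ih₁ h₁).1 (by simp)
  | loop_step _ _ _ ih₁ ih₂ ih₃ =>
    intro z t h'
    cases h' with
    | loop_done h₁ => exact absurd (ih₁ h₁).1 (by simp)
    | loop_step h₁ h₂ h₃ =>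
      obtain ⟨_, rfl⟩ := ih₁ h₁
      obtain ⟨rfl, rfl⟩ := ih₂ h₂
      obtain ⟨rfl, rfl⟩ := ih₃ h₃
      exact ⟨rfl, rfl⟩

/-! ### Encodings of inputs and outputs -/

namespace SExp

/-- Lists. -/
def ofList : List SExp → SExp
  | [] => .nil
  | a :: l => .cons a (ofList l)

/-- Truth values: `nil` is "no". -/
def ofBool : Bool → SExp
  | false => .nil
  | true => .cons .nil .nil

/-- Numbers, in unary. -/
def ofNat (m : ℕ) : SExp :=
  ofList (List.replicate m .nil)

open Classical in
/-- A truth value, as a bit. -/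
noncomputable def ofProp (P : Prop) : SExp :=
  ofBool (decide P)

/-- A set of vertices of a graph on `{0, …, n - 1}`: its characteristic vector. -/
noncomputable def ofVertexSet {n : ℕ} (X : Finset (Fin n)) : SExp :=
  ofList (List.ofFn fun i => ofProp (i ∈ X))

/-- A graph on `{0, …, n - 1}`: its adjacency matrix, as the list of its rows. -/
noncomputable def ofGraph {n : ℕ} (G : SimpleGraph (Fin n)) : SExp :=
  ofList (List.ofFn fun i => ofList (List.ofFn fun j => ofProp (G.Adj i j)))

/-- The pair of a graph and the parameter. -/
noncomputable def ofInstance {n : ℕ} (G : SimpleGraph (Fin n)) (l : ℕ) : SExp :=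
  .cons (ofGraph G) (ofNat l)

end SExp

/-! ### Problems and running times -/

open scoped NNReal in
/-- The program `A` is correct and runs in `O*(g(ℓ))` time on the connected graphs `G` that have a
chordal deletion of size `ℓ`, given with `ℓ`: on each such input it halts after at most
`C * g(ℓ) * n ^ c` steps (`n` the number of vertices of `G`, the constants `C` and `c` independent
of the input) with a result `y` such that `Good G ℓ y`. -/
def Prog.WorksInOStar (A : Prog)
    (Good : ∀ {n : ℕ}, SimpleGraph (Fin n) → ℕ → SExp → Prop) (g : ℕ → ℝ≥0) : Prop :=
  ∃ C c : ℕ, ∀ (n : ℕ) (G : SimpleGraph (Fin n)) (l : ℕ), G.Connected →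
    (∃ X : Finset (Fin n), X.card = l ∧ G.IsChordalDeletion X) →
      ∃ (y : SExp) (t : ℕ), A.Run (SExp.ofInstance G l) y t ∧ Good G l y ∧
        (t : ℝ≥0) ≤ C * g l * (n : ℝ≥0) ^ c

open scoped NNReal in
/-- `A` computes a chordal deletion of size `ℓ` of the input graph in `O*(f(ℓ))` time. -/
def Prog.ComputesChordalDeletion (A : Prog) (f : ℕ → ℝ≥0) : Prop :=
  A.WorksInOStar (fun {n} G l y => ∃ X : Finset (Fin n),
    X.card = l ∧ G.IsChordalDeletion X ∧ y = SExp.ofVertexSet X) f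

open scoped NNReal in
/-- `B` decides Independent Cutset in `O*(g(ℓ))` time, where the parameter `ℓ` is the size of a
chordal deletion of the input graph. -/
def Prog.DecidesIndependentCutset (B : Prog) (g : ℕ → ℝ≥0) : Prop :=
  B.WorksInOStar (fun G _ y => y = SExp.ofProp G.HasIndependentCutset) g

/-!
Let `X` be a chordal deletion of size `ℓ`. An independent cutset is the same as a colouring of the
vertices by `0`, `1` (the sides) and `2` (the cutset) in which no edge joins a `0` to a `1` or a `2`
to a `2`, and in which the colours `0` and `1` occur. The algorithm runs through the `3 ^ ℓ`
colourings of `X` and through all pairs of vertices `a`, `b` that are to be coloured `0` and `1`.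
Each of these cases is decided by *path consistency*: starting from all pairs of coloured vertices
that satisfy the constraints by themselves, pairs that do not extend to some third vertex are
discarded until nothing changes, and the case is accepted if every vertex retains a colour.

No solution is ever discarded (`iterate_refineRel_of_solution`). Conversely, let a colour be left
for every vertex. The vertices of `X` have only one colour each, and the pairs that remain are
consistent with it. The chordal graph `G - X` has a perfect elimination ordering
(`SimpleGraph.IsChordal.exists_simplicial`), along which it can be coloured in reverse: the
neighbours of the next vertex that are already coloured form a clique, whose colours are, with at
most one exception, all `0` or all `1`. For such a clique it suffices that each two of its vertices
leave a colour for the next vertex (`exists_color_of_pairwise`), and this is path consistency. The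
algorithm does not need to know the ordering.

For the running time, `Comp n w x y` says that a single program computes `y i` from `x i` for all
indices `i`, in time `w i` times a polynomial in `n i`. This relation is closed under the usual ways
to build programs, in particular under iteration along a list (`Comp.fold`), where the weights of
one round and of the length of the list multiply. Path consistency has weight `1`
(`PolyComp.accepts`), and the list of the colourings of `X` has length `3 ^ ℓ` and is computed with
weight `3 ^ ℓ` (`Comp.branch`).
-/

open scoped NNReal
open SExp

/-! ### Polynomial bounds -/

/-- `b` is at most `w` times a polynomial in `n`, uniformly in the index. -/
def PolyBd {ι : Type} (n : ι → ℕ) (w b : ι → ℝ≥0) : Prop :=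
  ∃ C c : ℕ, ∀ i, b i ≤ C * w i * ((n i : ℝ≥0) + 1) ^ c

namespace PolyBd

variable {ι : Type} {n : ι → ℕ} {w w₁ w₂ b b₁ b₂ : ι → ℝ≥0}

theorem mono (h : PolyBd n w₁ b₁) (hb : ∀ i, b i ≤ b₁ i) (hw : ∀ i, w₁ i ≤ w i) :
    PolyBd n w b := by
  obtain ⟨C, c, h⟩ := h
  refine ⟨C, c, fun i => (hb i).trans ((h i).trans ?_)⟩
  gcongr
  exact hw i

theorem add (h₁ : PolyBd n w b₁) (h₂ : PolyBd n w b₂) : PolyBd n w (fun i => b₁ i + b₂ i) := by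
  obtain ⟨C, c, h₁⟩ := h₁
  obtain ⟨D, d, h₂⟩ := h₂
  refine ⟨C + D, c + d, fun i => ?_⟩
  have hn : (1 : ℝ≥0) ≤ (n i : ℝ≥0) + 1 := by simp
  calc b₁ i + b₂ i ≤ C * w i * ((n i : ℝ≥0) + 1) ^ c + D * w i * ((n i : ℝ≥0) + 1) ^ d :=
        add_le_add (h₁ i) (h₂ i)
    _ ≤ C * w i * ((n i : ℝ≥0) + 1) ^ (c + d) + D * w i * ((n i : ℝ≥0) + 1) ^ (c + d) := by
        gcongr <;> first | exact hn | omega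
    _ = _ := by push_cast; ring

theorem mul (h₁ : PolyBd n w₁ b₁) (h₂ : PolyBd n w₂ b₂) :
    PolyBd n (fun i => w₁ i * w₂ i) (fun i => b₁ i * b₂ i) := by
  obtain ⟨C, c, h₁⟩ := h₁
  obtain ⟨D, d, h₂⟩ := h₂
  refine ⟨C * D, c + d, fun i => ?_⟩
  calc b₁ i * b₂ i
      ≤ (C * w₁ i * ((n i : ℝ≥0) + 1) ^ c) * (D * w₂ i * ((n i : ℝ≥0) + 1) ^ d) :=
        mul_le_mul' (h₁ i) (h₂ i)
    _ = _ := by push_cast; ring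

theorem const (k : ℕ) (hw : ∀ i, 1 ≤ w i) : PolyBd n w (fun _ => k) :=
  ⟨k, 0, fun i => by simpa using le_mul_of_one_le_right (by simp) (hw i)⟩

theorem self : PolyBd n (fun _ => 1) (fun i => n i) :=
  ⟨1, 1, fun i => by simp⟩

theorem comp {κ : Type} (h : PolyBd n w b) (g : κ → ι) :
    PolyBd (fun j => n (g j)) (fun j => w (g j)) (fun j => b (g j)) := by
  obtain ⟨C, c, h⟩ := h
  exact ⟨C, c, fun i => h (g i)⟩

end PolyBd

/-! ### Uniform families of computations -/

theorem Prog.Run.pos {p : Prog} {x y : SExp} {t : ℕ} (h : p.Run x y t) : 1 ≤ t := by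
  cases h <;> omega

/-- One program computes `y i` from `x i` for all indices `i` at once, in time at most `w i` times
a polynomial in `n i`. The index plays the role of the values of the variables that are in scope,
and `x i` is the run-time representation of these values: the loop rules below pass from `ι` to
`Σ i, Fin (N i)` and from `x i` to a pair whose second component represents the loop variable. So
programs are given by derivations of `Comp`, and never written down. -/
def Comp {ι : Type} (n : ι → ℕ) (w : ι → ℝ≥0) (x y : ι → SExp) : Prop :=
  ∃ (p : Prog) (T : ι → ℕ), (∀ i, p.Run (x i) (y i) (T i)) ∧ PolyBd n w (fun i => T i)

namespace Comp

variable {ι : Type} {n : ι → ℕ} {w w₁ w₂ : ι → ℝ≥0} {x y z : ι → SExp}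

theorem mono (h : Comp n w₁ x y) (hw : ∀ i, w₁ i ≤ w i) : Comp n w x y := by
  obtain ⟨p, T, hp, hT⟩ := h
  exact ⟨p, T, hp, hT.mono (fun _ => le_rfl) hw⟩

theorem reindex {κ : Type} (h : Comp n w x y) (g : κ → ι) :
    Comp (fun j => n (g j)) (fun j => w (g j)) (fun j => x (g j)) (fun j => y (g j)) := by
  obtain ⟨p, T, hp, hT⟩ := h
  exact ⟨p, fun j => T (g j), fun j => hp (g j), hT.comp g⟩

theorem id (hw : ∀ i, 1 ≤ w i) : Comp n w x x :=
  ⟨.id, fun _ => 1, fun _ => .id _, .const 1 hw⟩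

theorem nil (hw : ∀ i, 1 ≤ w i) : Comp n w x (fun _ => .nil) :=
  ⟨.nil, fun _ => 1, fun _ => .nil _, .const 1 hw⟩

theorem seq (h₁ : Comp n w x y) (h₂ : Comp n w y z) : Comp n w x z := by
  obtain ⟨p, S, hp, hS⟩ := h₁
  obtain ⟨q, T, hq, hT⟩ := h₂
  refine ⟨.seq p q, fun i => S i + T i + 1, fun i => (hp i).seq (hq i),
    ((hS.add hT).add hT).mono (fun i => ?_) (fun _ => le_rfl)⟩
  have := (hq i).pos
  norm_cast
  dsimp only
  omega

theorem cons (h₁ : Comp n w x y) (h₂ : Comp n w x z) :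
    Comp n w x (fun i => .cons (y i) (z i)) := by
  obtain ⟨p, S, hp, hS⟩ := h₁
  obtain ⟨q, T, hq, hT⟩ := h₂
  refine ⟨.cons p q, fun i => S i + T i + 1, fun i => (hp i).cons (hq i),
    ((hS.add hT).add hT).mono (fun i => ?_) (fun _ => le_rfl)⟩
  have := (hq i).pos
  norm_cast
  dsimp only
  omega

theorem fst (hw : ∀ i, 1 ≤ w i) : Comp n w (fun i => .cons (x i) (y i)) x :=
  ⟨.head, fun _ => 1, fun _ => .head_cons _ _, .const 1 hw⟩

theorem snd (hw : ∀ i, 1 ≤ w i) : Comp n w (fun i => .cons (x i) (y i)) y :=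
  ⟨.tail, fun _ => 1, fun _ => .tail_cons _ _, .const 1 hw⟩

theorem tail {a b : ι → SExp} (h : Comp n w x (fun i => .cons (a i) (b i)))
    (hw : ∀ i, 1 ≤ w i) : Comp n w x b :=
  h.seq (snd hw)

theorem ofList_tail {l : ι → List SExp} (h : Comp n w x (fun i => .ofList (l i)))
    (hw : ∀ i, 1 ≤ w i) : Comp n w x (fun i => .ofList (l i).tail) := by
  refine h.seq ⟨.tail, fun _ => 1, fun i => ?_, .const 1 hw⟩
  dsimp only
  rcases l i with _ | ⟨a, l⟩
  · exact .tail_nil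
  · exact .tail_cons _ _

theorem ofList_head {l : ι → List SExp} {a : ι → SExp} (h : Comp n w x (fun i => .ofList (l i)))
    (ha : ∀ i, (l i).head? = some (a i)) (hw : ∀ i, 1 ≤ w i) : Comp n w x a := by
  refine h.seq ⟨.head, fun _ => 1, fun i => ?_, .const 1 hw⟩
  obtain ⟨l', hl⟩ := List.head?_eq_some_iff.mp (ha i)
  dsimp only
  rw [hl]
  exact .head_cons _ _

/-- Any fixed S-expression can be written down. -/
theorem const (a : SExp) (hw : ∀ i, 1 ≤ w i) : Comp n w x (fun _ => a) := by
  induction a with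
  | nil => exact nil hw
  | cons a b iha ihb => exact iha.cons ihb

end Comp

/-- The loop that underlies all iterations: the state consists of the input `x`, of the part of the
list `l` that is still to be processed, and of an accumulator that passes through `s 0`, `s 1`, …;
each round takes time at most `B` for the new accumulator, and a constant for bookkeeping. -/
theorem Prog.Run.loop_list {p : Prog} {x : SExp} {l : List SExp} {s : ℕ → SExp} {B : ℝ≥0}
    (h : ∀ k < l.length, ∃ t : ℕ,
      p.Run (.cons (.cons x (.ofList (l.drop k))) (s k)) (s (k + 1)) t ∧ (t : ℝ≥0) ≤ B)
    (m k : ℕ) (hk : k + m = l.length) :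
    ∃ t : ℕ, (Prog.loop (.seq .head .tail)
        (.cons (.cons (.seq .head .head) (.seq .head (.seq .tail .tail))) p)).Run
      (.cons (.cons x (.ofList (l.drop k))) (s k)) (.cons (.cons x .nil) (s l.length)) t ∧
      (t : ℝ≥0) ≤ m * (B + 14) + 4 := by
  induction m generalizing k with
  | zero =>
    obtain rfl : k = l.length := by omega
    rw [List.drop_length]
    exact ⟨_, .loop_done (.seq (.head_cons _ _) (.tail_cons _ _)), by norm_num⟩
  | succ m ih =>
    obtain ⟨t, ht, htB⟩ := ih (k + 1) (by omega)
    obtain ⟨u, hu, huB⟩ := h k (by omega)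
    rw [List.drop_eq_getElem_cons (show k < l.length by omega)] at hu ⊢
    refine ⟨_, .loop_step (.seq (.head_cons _ _) (.tail_cons _ _))
      (.cons (.cons (.seq (.head_cons _ _) (.head_cons _ _))
        (.seq (.head_cons _ _) (.seq (.tail_cons _ _) (.tail_cons _ _)))) hu) ht, ?_⟩
    have : (((1 + 1 + 1 + (1 + 1 + 1 + (1 + (1 + 1 + 1) + 1) + 1 + u + 1) + t + 1 : ℕ)) : ℝ≥0)
        = u + t + 14 := by push_cast; ring
    rw [this]
    calc (u : ℝ≥0) + t + 14 ≤ B + (m * (B + 14) + 4) + 14 := by gcongr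
      _ = _ := by push_cast; ring

namespace Comp

variable {ι : Type} {n : ι → ℕ} {w w₁ w₂ : ι → ℝ≥0} {x y z : ι → SExp}

/-- Iteration along a list. The time of the whole loop is the time of one round times the length
of the list, so that an exponential weight may enter through either of them. -/
theorem fold {l : ι → List SExp} {s : ι → ℕ → SExp}
    (hl : Comp n w x (fun i => .ofList (l i))) (h₀ : Comp n w x (fun i => s i 0))
    (hs : Comp (ι := Σ i, Fin (l i).length) (fun p => n p.1) (fun p => w₁ p.1)
      (fun p => .cons (.cons (x p.1) (.ofList ((l p.1).drop p.2))) (s p.1 p.2))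
      (fun p => s p.1 (p.2 + 1)))
    (hN : PolyBd n w₂ (fun i => (l i).length)) (hw₁ : ∀ i, 1 ≤ w₁ i)
    (hw : ∀ i, w₁ i * w₂ i ≤ w i) (hw' : ∀ i, 1 ≤ w i) :
    Comp n w x (fun i => s i (l i).length) := by
  have hinit := ((id hw').cons hl).cons h₀
  suffices h : Comp n w (fun i => .cons (.cons (x i) (.ofList (l i))) (s i 0))
      (fun i => .cons (.cons (x i) .nil) (s i (l i).length)) from (hinit.seq h).tail hw'
  obtain ⟨p, T, hp, C, c, hT⟩ := hs
  have hrun := fun i => Prog.Run.loop_list (p := p) (x := x i) (l := l i) (s := s i)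
    (B := C * w₁ i * ((n i : ℝ≥0) + 1) ^ c)
    (fun k hk => ⟨T ⟨i, k, hk⟩, hp ⟨i, k, hk⟩, hT ⟨i, k, hk⟩⟩) (l i).length 0 (by simp)
  choose t ht htB using hrun
  refine ⟨_, t, ht, PolyBd.mono (PolyBd.add ((hN.mul (w₂ := w₁)
    (PolyBd.add ⟨C, c, fun i => le_rfl⟩ (.const 14 hw₁))).mono (fun i => le_rfl)
      fun i => (mul_comm _ _).trans_le (hw i)) (.const 4 hw')) (fun i => ?_) (fun _ => le_rfl)⟩
  exact_mod_cast htB i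

end Comp

/-! ### Data in polynomial time -/

namespace SExp

/-- The table of the values of a function. -/
def tab {N : ℕ} (f : Fin N → SExp) : SExp :=
  ofList (List.ofFn f)

theorem ofNat_succ (m : ℕ) : ofNat (m + 1) = .cons .nil (ofNat m) := rfl

theorem ofProp_of {P : Prop} (h : P) : ofProp P = .cons .nil .nil := by simp [ofProp, ofBool, h]

theorem ofProp_of_not {P : Prop} (h : ¬ P) : ofProp P = .nil := by simp [ofProp, ofBool, h]

theorem ofProp_congr {P Q : Prop} (h : P ↔ Q) : ofProp P = ofProp Q := by rw [propext h]

end SExp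

/-- Computability in polynomial time. -/
abbrev PolyComp {ι : Type} (n : ι → ℕ) (x y : ι → SExp) : Prop :=
  Comp n (fun _ => 1) x y

namespace Comp

variable {ι : Type} {n : ι → ℕ} {w : ι → ℝ≥0} {x y z : ι → SExp}

theorem congr (h : Comp n w x y) (hyz : ∀ i, y i = z i) : Comp n w x z := by
  rwa [← funext hyz]

open Classical in
theorem ite_nil {c : ι → SExp} {P : ι → Prop} (hc : Comp n w x c) (hP : ∀ i, P i ↔ c i ≠ .nil)
    (h₁ : Comp n w x y) (h₂ : Comp n w x z) :
    Comp n w x (fun i => if P i then y i else z i) := by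
  obtain ⟨r, R, hr, hR⟩ := hc
  obtain ⟨p, S, hp, hS⟩ := h₁
  obtain ⟨q, T, hq, hT⟩ := h₂
  refine ⟨.ite r p q, fun i => R i + (if P i then S i else T i) + 1, fun i => ?_,
    (((hR.add hS).add hT).add hR).mono (fun i => ?_) (fun _ => le_rfl)⟩
  · have hi := hr i
    have hPi := hP i
    rcases h : c i with _ | ⟨a, b⟩ <;> rw [h] at hi hPi
    · simp only [hPi.not.mpr (by simp), if_false]
      exact .ite_false hi (hq i)
    · simp only [hPi.mpr (by simp), if_true]
      exact .ite_true hi (hp i)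
  · have := (hr i).pos
    norm_cast
    dsimp only
    split_ifs <;> omega

open Classical in
theorem ite {P : ι → Prop} (hP : Comp n w x (fun i => ofProp (P i)))
    (h₁ : Comp n w x y) (h₂ : Comp n w x z) :
    Comp n w x (fun i => if P i then y i else z i) := by
  refine hP.ite_nil (fun i => ?_) h₁ h₂
  by_cases h : P i <;> simp [h, ofProp_of, ofProp_of_not]

/-- Iteration with a counter that runs down from `N` to `0`. -/
theorem countdown {N : ι → ℕ} {s : ι → ℕ → SExp}
    (hN : Comp n w x (fun i => ofNat (N i))) (hb : PolyBd n (fun _ => 1) (fun i => N i))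
    (hw : ∀ i, 1 ≤ w i) (h₀ : Comp n w x (fun i => s i (N i)))
    (hs : Comp (ι := Σ i, Fin (N i)) (fun p => n p.1) (fun p => w p.1)
      (fun p => .cons (.cons (x p.1) (ofNat p.2)) (s p.1 (p.2 + 1))) (fun p => s p.1 p.2)) :
    Comp n w x (fun i => s i 0) := by
  have key := fold (n := n) (w := w) (w₁ := w) (w₂ := fun _ => 1) (x := x)
    (l := fun i => List.replicate (N i) .nil) (s := fun i j => s i (N i - j)) hN (by simpa using h₀)
    ?_ (by simpa using hb) hw (by simp) hw
  · exact key.congr fun i => by simp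
  · have hlt : ∀ p : Σ i, Fin (List.replicate (N i) SExp.nil).length, (p.2 : ℕ) < N p.1 :=
      fun p => p.2.2.trans_eq List.length_replicate
    let g : (Σ i, Fin (List.replicate (N i) SExp.nil).length) → Σ i, Fin (N i) := fun p =>
      ⟨p.1, ⟨N p.1 - 1 - p.2, by have := hlt p; omega⟩⟩
    have hg : ∀ p, N p.1 - p.2 = (g p).2 + 1 := fun p => by
      have := hlt p
      simp only [g]
      omega
    have hw' : ∀ p : Σ i, Fin (List.replicate (N i) SExp.nil).length, 1 ≤ w p.1 := fun p => hw p.1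
    refine (Comp.seq (y := fun p => .cons (.cons (x p.1) (ofNat (g p).2)) (s p.1 ((g p).2 + 1)))
      ?_ (hs.reindex g)).congr fun p => ?_
    · refine .cons (.cons ((fst hw').seq (fst hw')) ?_) ((snd hw').congr fun p => by rw [hg])
      refine (((fst hw').seq (snd hw')).ofList_tail hw').congr fun p => ?_
      rw [List.drop_replicate, hg, List.replicate_succ]
      rfl
    · have := hg p
      congr 1
      omega

end Comp

namespace PolyComp

variable {ι : Type} {n : ι → ℕ} {x : ι → SExp}

theorem id : PolyComp n x x := Comp.id fun _ => le_rfl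

theorem fst {y : ι → SExp} : PolyComp n (fun i => .cons (x i) (y i)) x := Comp.fst fun _ => le_rfl

theorem snd {y : ι → SExp} : PolyComp n (fun i => .cons (x i) (y i)) y := Comp.snd fun _ => le_rfl

theorem const (a : SExp) : PolyComp n x (fun _ => a) := Comp.const a fun _ => le_rfl

/-- What was computable stays so when a new variable comes into scope. -/
theorem skip {y z : ι → SExp} (h : PolyComp n x y) :
    PolyComp n (fun i => .cons (x i) (z i)) y :=
  fst.seq h

/-! ### Propositions -/

section Propositions

variable {P Q : ι → Prop}

theorem and (hP : PolyComp n x (fun i => ofProp (P i)))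
    (hQ : PolyComp n x (fun i => ofProp (Q i))) :
    PolyComp n x (fun i => ofProp (P i ∧ Q i)) :=
  (hP.ite hQ (const .nil)).congr fun i => by
    by_cases h : P i <;> simp [h, ofProp_of_not]

theorem not (hP : PolyComp n x (fun i => ofProp (P i))) : PolyComp n x (fun i => ofProp (¬ P i)) :=
  (hP.ite (const .nil) (const (.cons .nil .nil))).congr fun i => by
    by_cases h : P i <;> simp [h, ofProp_of, ofProp_of_not]

theorem or (hP : PolyComp n x (fun i => ofProp (P i))) (hQ : PolyComp n x (fun i => ofProp (Q i))) :
    PolyComp n x (fun i => ofProp (P i ∨ Q i)) :=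
  (hP.not.and hQ.not).not.congr fun i => ofProp_congr (by tauto)

theorem imp (hP : PolyComp n x (fun i => ofProp (P i)))
    (hQ : PolyComp n x (fun i => ofProp (Q i))) :
    PolyComp n x (fun i => ofProp (P i → Q i)) :=
  (hP.not.or hQ).congr fun i => ofProp_congr (by tauto)

theorem all {N : ι → ℕ} {P : ∀ i, Fin (N i) → Prop} (hN : PolyComp n x (fun i => ofNat (N i)))
    (hb : PolyBd n (fun _ => 1) (fun i => N i))
    (h : PolyComp (ι := Σ i, Fin (N i)) (fun p => n p.1) (fun p => .cons (x p.1) (ofNat p.2))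
      (fun p => ofProp (P p.1 p.2))) :
    PolyComp n x (fun i => ofProp (∀ k, P i k)) := by
  refine (Comp.countdown (s := fun i j => ofProp (∀ k : Fin (N i), j ≤ k → P i k)) hN hb
    (fun _ => le_rfl) ((const (.cons .nil .nil)).congr fun i => (ofProp_of ?_).symm) ?_).congr
      fun i => ofProp_congr (by simp)
  · exact fun k hk => absurd k.2 (by omega)
  · refine (and (skip h) snd).congr fun p => ofProp_congr ⟨fun h k hk => ?_, fun h => ?_⟩
    · obtain hk | hk := hk.eq_or_lt
      · rw [← Fin.ext hk]
        exact h.1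
      · exact h.2 k hk
    · exact ⟨h p.2 le_rfl, fun k hk => h k (by omega)⟩

theorem any {N : ι → ℕ} {P : ∀ i, Fin (N i) → Prop} (hN : PolyComp n x (fun i => ofNat (N i)))
    (hb : PolyBd n (fun _ => 1) (fun i => N i))
    (h : PolyComp (ι := Σ i, Fin (N i)) (fun p => n p.1) (fun p => .cons (x p.1) (ofNat p.2))
      (fun p => ofProp (P p.1 p.2))) :
    PolyComp n x (fun i => ofProp (∃ k, P i k)) :=
  (all (P := fun i k => ¬ P i k) hN hb h.not).not.congr fun i => ofProp_congr (by simp)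

end Propositions

/-! ### Numbers -/

section Numbers

variable {a b : ι → ℕ}

theorem sub (ha : PolyComp n x (fun i => ofNat (a i))) (hb : PolyComp n x (fun i => ofNat (b i)))
    (hb' : PolyBd n (fun _ => 1) (fun i => b i)) :
    PolyComp n x (fun i => ofNat (a i - b i)) := by
  refine (Comp.countdown (s := fun i j => ofNat (a i - (b i - j))) hb hb' (fun _ => le_rfl)
    (ha.congr fun i => by simp) ?_).congr fun i => by simp
  refine (Comp.ofList_tail (l := fun p : Σ i, Fin (b i) => List.replicate _ _)
    snd fun _ => le_rfl).congr fun p => ?_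
  rw [List.tail_replicate, ofNat]
  congr 2
  omega

theorem eq_zero (ha : PolyComp n x (fun i => ofNat (a i))) :
    PolyComp n x (fun i => ofProp (a i = 0)) := by
  refine (ha.ite_nil (P := fun i => a i ≠ 0) (fun i => ?_) (const .nil)
    (const (.cons .nil .nil))).congr fun i => ?_
  · rcases a i with _ | m
    · simp [ofNat, ofList]
    · simp [ofNat_succ]
  · by_cases h : a i = 0 <;> simp [h, ofProp_of, ofProp_of_not]

theorem eq (ha : PolyComp n x (fun i => ofNat (a i))) (hb : PolyComp n x (fun i => ofNat (b i)))
    (ha' : PolyBd n (fun _ => 1) (fun i => a i)) (hb' : PolyBd n (fun _ => 1) (fun i => b i)) :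
    PolyComp n x (fun i => ofProp (a i = b i)) :=
  ((ha.sub hb hb').eq_zero.and (hb.sub ha ha').eq_zero).congr fun i => ofProp_congr (by omega)

theorem add (ha : PolyComp n x (fun i => ofNat (a i))) (hb : PolyComp n x (fun i => ofNat (b i)))
    (hb' : PolyBd n (fun _ => 1) (fun i => b i)) :
    PolyComp n x (fun i => ofNat (a i + b i)) := by
  refine (Comp.countdown (s := fun i j => ofNat (a i + (b i - j))) hb hb' (fun _ => le_rfl)
    (ha.congr fun i => by simp) ?_).congr fun i => by simp
  refine (Comp.cons (const .nil) snd).congr fun p => ?_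
  rw [← ofNat_succ]
  congr 1
  omega

theorem mul (ha : PolyComp n x (fun i => ofNat (a i))) (hb : PolyComp n x (fun i => ofNat (b i)))
    (ha' : PolyBd n (fun _ => 1) (fun i => a i)) (hb' : PolyBd n (fun _ => 1) (fun i => b i)) :
    PolyComp n x (fun i => ofNat (a i * b i)) := by
  refine (Comp.countdown (s := fun i j => ofNat ((a i - j) * b i)) ha ha' (fun _ => le_rfl)
    ((const .nil).congr fun i => by simp [ofNat, ofList]) ?_).congr fun i => by simp
  refine (add (ι := Σ i, Fin (a i)) snd (skip (skip (hb.reindex Sigma.fst)))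
    (hb'.comp Sigma.fst)).congr fun p => ?_
  rw [← Nat.succ_mul]
  congr 2
  omega

end Numbers

/-! ### Lists and tables -/

theorem drop {k : ι → ℕ} {l : ι → List SExp} (hk : PolyComp n x (fun i => ofNat (k i)))
    (hk' : PolyBd n (fun _ => 1) (fun i => k i)) (hl : PolyComp n x (fun i => ofList (l i))) :
    PolyComp n x (fun i => ofList ((l i).drop (k i))) := by
  refine (Comp.countdown (s := fun i j => ofList ((l i).drop (k i - j))) hk hk' (fun _ => le_rfl)
    (hl.congr fun i => by simp) ?_).congr fun i => by simp
  refine (Comp.ofList_tail snd fun _ => le_rfl).congr fun p => ?_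
  rw [List.tail_drop]
  congr 2
  omega

/-- Random access to a list. -/
theorem getElem {k : ι → ℕ} {l : ι → List SExp} (hl : PolyComp n x (fun i => ofList (l i)))
    (hk : PolyComp n x (fun i => ofNat (k i))) (hk' : PolyBd n (fun _ => 1) (fun i => k i))
    (hkl : ∀ i, k i < (l i).length) :
    PolyComp n x (fun i => (l i)[k i]'(hkl i)) :=
  (drop hk hk' hl).ofList_head (fun i => by simp [hkl i]) fun _ => le_rfl

/-- Random access to a table. -/
theorem get {N : ι → ℕ} {g : ∀ i, Fin (N i) → SExp} {k : ∀ i, Fin (N i)}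
    (hg : PolyComp n x (fun i => SExp.tab (g i))) (hk : PolyComp n x (fun i => ofNat (k i)))
    (hb : PolyBd n (fun _ => 1) (fun i => N i)) :
    PolyComp n x (fun i => g i (k i)) :=
  (getElem hg hk (hb.mono (fun i => by exact_mod_cast (k i).2.le) fun _ => le_rfl)
    fun i => by simp).congr fun i => by simp

/-- Tabulation of a function. -/
theorem tab {N : ι → ℕ} {g : ∀ i, Fin (N i) → SExp} (hN : PolyComp n x (fun i => ofNat (N i)))
    (hb : PolyBd n (fun _ => 1) (fun i => N i))
    (h : PolyComp (ι := Σ i, Fin (N i)) (fun p => n p.1) (fun p => .cons (x p.1) (ofNat p.2))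
      (fun p => g p.1 p.2)) :
    PolyComp n x (fun i => SExp.tab (g i)) := by
  refine (Comp.countdown (s := fun i j => ofList ((List.ofFn (g i)).drop j)) hN hb
    (fun _ => le_rfl) ((const .nil).congr fun i => ?_) ?_).congr fun i => by simp [SExp.tab]
  · rw [List.drop_eq_nil_of_le (by simp), ofList]
  · refine (Comp.cons (skip h) snd).congr fun p => ?_
    rw [List.drop_eq_getElem_cons (i := (p.2 : ℕ)) (by simp), ofList]
    simp

theorem length {l : ι → List SExp} (hl : PolyComp n x (fun i => ofList (l i)))
    (hb : PolyBd n (fun _ => 1) (fun i => (l i).length)) :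
    PolyComp n x (fun i => ofNat (l i).length) :=
  Comp.fold (s := fun _ j => ofNat j) (w₁ := fun _ => 1) hl (const .nil)
    (Comp.cons (const .nil) snd) hb (fun _ => le_rfl) (by simp) (fun _ => le_rfl)

end PolyComp

/-! ### The algorithm: path consistency -/

/-- The colours `0` and `1` stand for the two sides of a cutset and `2` for the cutset itself.
Vertices joined by an edge must have compatible colours. -/
def Compat (x y : Fin 3) : Prop :=
  ¬ (x = 0 ∧ y = 1) ∧ ¬ (x = 1 ∧ y = 0) ∧ ¬ (x = 2 ∧ y = 2)

/-- `M u x v y`: it is not yet excluded that `u` gets the colour `x` and `v` the colour `y`. -/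
abbrev ColorRel (n : ℕ) : Type :=
  Fin n → Fin 3 → Fin n → Fin 3 → Prop

/-- The colour `x` is admissible for `u` if it is the one prescribed by `τ` (the value `3` meaning
that nothing is prescribed); moreover `a` must get the colour `0`, and `b` the colour `1`. -/
def Allowed {n : ℕ} (τ : Fin n → Fin 4) (a b u : Fin n) (x : Fin 3) : Prop :=
  ((τ u : ℕ) = 3 ∨ (τ u : ℕ) = x) ∧ (u = a → x = 0) ∧ (u = b → x = 1)

/-- The pairs of coloured vertices that satisfy all constraints by themselves. -/
def initRel {n : ℕ} (G : SimpleGraph (Fin n)) (τ : Fin n → Fin 4) (a b : Fin n) : ColorRel n :=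
  fun u x v y => Allowed τ a b u x ∧ Allowed τ a b v y ∧ (u = v → x = y) ∧ (G.Adj u v → Compat x y)

/-- One round of path consistency: a pair survives if it extends to every third vertex. -/
def refineRel {n : ℕ} (M : ColorRel n) : ColorRel n :=
  fun u x v y => M u x v y ∧ ∀ w, ∃ z, M u x w z ∧ M w z v y

/-- For some choice of `a` and `b`, path consistency leaves a colour for every vertex. The number
of rounds is the number of pairs of coloured vertices. -/
def Accepts {n : ℕ} (G : SimpleGraph (Fin n)) (τ : Fin n → Fin 4) : Prop :=
  ∃ a b : Fin n, ∀ v, ∃ z, refineRel^[3 * n * (3 * n)] (initRel G τ a b) v z v z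

/-- The representation of a relation by a table. -/
noncomputable def SExp.ofColorRel {n : ℕ} (M : ColorRel n) : SExp :=
  .tab fun u => .tab fun x => .tab fun v => .tab fun y => ofProp (M u x v y)

namespace PolyComp

variable {ι : Type} {n : ι → ℕ} {x : ι → SExp}

theorem fin_eq {N : ι → ℕ} {u v : ∀ i, Fin (N i)} (hu : PolyComp n x (fun i => ofNat (u i)))
    (hv : PolyComp n x (fun i => ofNat (v i))) (hb : PolyBd n (fun _ => 1) (fun i => N i)) :
    PolyComp n x (fun i => ofProp (u i = v i)) :=
  (eq hu hv (hb.mono (fun i => by exact_mod_cast (u i).2.le) fun _ => le_rfl)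
    (hb.mono (fun i => by exact_mod_cast (v i).2.le) fun _ => le_rfl)).congr
      fun i => ofProp_congr Fin.ext_iff.symm

theorem bound_three {m : ι → ℕ} : PolyBd m (fun _ => 1) (fun _ => (3 : ℕ)) :=
  .const 3 fun _ => le_rfl

theorem three : PolyComp n x (fun _ => ofNat 3) := const _

theorem color_eq {u : ι → Fin 3} (c : Fin 3) (hu : PolyComp n x (fun i => ofNat (u i))) :
    PolyComp n x (fun i => ofProp (u i = c)) :=
  fin_eq (N := fun _ => 3) (v := fun _ => c) hu (const _) bound_three

theorem compat {c d : ι → Fin 3} (hc : PolyComp n x (fun i => ofNat (c i)))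
    (hd : PolyComp n x (fun i => ofNat (d i))) :
    PolyComp n x (fun i => ofProp (Compat (c i) (d i))) :=
  ((hc.color_eq 0).and (hd.color_eq 1)).not.and <|
    ((hc.color_eq 1).and (hd.color_eq 0)).not.and ((hc.color_eq 2).and (hd.color_eq 2)).not

theorem allowed {τ : ∀ i, Fin (n i) → Fin 4} {a b u : ∀ i, Fin (n i)} {c : ι → Fin 3}
    (hτ : PolyComp n x (fun i => SExp.tab fun v => ofNat (τ i v)))
    (ha : PolyComp n x (fun i => ofNat (a i))) (hb : PolyComp n x (fun i => ofNat (b i)))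
    (hu : PolyComp n x (fun i => ofNat (u i))) (hc : PolyComp n x (fun i => ofNat (c i))) :
    PolyComp n x (fun i => ofProp (Allowed (τ i) (a i) (b i) (u i) (c i))) := by
  have hτu := get hτ hu .self
  have hbd : PolyBd n (fun _ => 1) (fun i => (τ i (u i) : ℕ)) :=
    bound_three.mono (fun i => by exact_mod_cast Nat.le_of_lt_succ (τ i (u i)).2) fun _ => le_rfl
  have hbd' : PolyBd n (fun _ => 1) (fun i => (c i : ℕ)) :=
    bound_three.mono (fun i => by exact_mod_cast (c i).2.le) fun _ => le_rfl
  exact ((hτu.eq three hbd bound_three).or (hτu.eq hc hbd hbd')).and <|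
    ((hu.fin_eq ha .self).imp (hc.color_eq 0)).and ((hu.fin_eq hb .self).imp (hc.color_eq 1))

theorem relAt {M : ∀ i, ColorRel (n i)} {u v : ∀ i, Fin (n i)} {c d : ι → Fin 3}
    (hM : PolyComp n x (fun i => ofColorRel (M i)))
    (hu : PolyComp n x (fun i => ofNat (u i))) (hc : PolyComp n x (fun i => ofNat (c i)))
    (hv : PolyComp n x (fun i => ofNat (v i))) (hd : PolyComp n x (fun i => ofNat (d i))) :
    PolyComp n x (fun i => ofProp (M i (u i) (c i) (v i) (d i))) :=
  get (get (get (get hM hu .self) hc bound_three) hv .self) hd bound_three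

theorem adj {G : ∀ i, SimpleGraph (Fin (n i))} {u v : ∀ i, Fin (n i)}
    (hG : PolyComp n x (fun i => ofGraph (G i)))
    (hu : PolyComp n x (fun i => ofNat (u i))) (hv : PolyComp n x (fun i => ofNat (v i))) :
    PolyComp n x (fun i => ofProp ((G i).Adj (u i) (v i))) :=
  get (g := fun i w => ofProp ((G i).Adj (u i) w))
    (get (g := fun i u => SExp.tab fun w => ofProp ((G i).Adj u w)) hG hu .self) hv .self

theorem tabRel {M : ∀ i, ColorRel (n i)} (hn : PolyComp n x (fun i => ofNat (n i)))
    (h : PolyComp (ι := Σ _ : Σ p : Σ _ : Σ i, Fin (n i), Fin 3, Fin (n p.1.1), Fin 3)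
      (fun p => n p.1.1.1.1)
      (fun p => .cons (.cons (.cons (.cons (x p.1.1.1.1) (ofNat p.1.1.1.2)) (ofNat p.1.1.2))
        (ofNat p.1.2)) (ofNat p.2))
      (fun p => ofProp (M p.1.1.1.1 p.1.1.1.2 p.1.1.2 p.1.2 p.2))) :
    PolyComp n x (fun i => ofColorRel (M i)) :=
  tab hn .self <| tab three bound_three <|
    tab (skip (skip (hn.reindex _))) .self <| tab three bound_three h

theorem init {G : ∀ i, SimpleGraph (Fin (n i))} {τ : ∀ i, Fin (n i) → Fin 4}
    {a b : ∀ i, Fin (n i)} (hn : PolyComp n x (fun i => ofNat (n i)))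
    (hG : PolyComp n x (fun i => ofGraph (G i)))
    (hτ : PolyComp n x (fun i => SExp.tab fun v => ofNat (τ i v)))
    (ha : PolyComp n x (fun i => ofNat (a i))) (hb : PolyComp n x (fun i => ofNat (b i))) :
    PolyComp n x (fun i => ofColorRel (initRel (G i) (τ i) (a i) (b i))) := by
  refine tabRel hn (and (allowed ?_ ?_ ?_ ?_ ?_) (and (allowed ?_ ?_ ?_ ?_ ?_)
    (and (imp (fin_eq ?_ ?_ .self) (fin_eq ?_ ?_ bound_three))
      (imp (adj ?_ ?_ ?_) (compat ?_ ?_)))))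
  all_goals
    repeat
      first
      | exact snd
      | exact hG.reindex _
      | exact hτ.reindex _
      | exact ha.reindex _
      | exact hb.reindex _
      | apply skip

theorem refine {M : ∀ i, ColorRel (n i)} (hn : PolyComp n x (fun i => ofNat (n i)))
    (hM : PolyComp n x (fun i => ofColorRel (M i))) :
    PolyComp n x (fun i => ofColorRel (refineRel (M i))) := by
  refine tabRel hn (and (relAt ?_ ?_ ?_ ?_ ?_) (all ?_ .self <| any three bound_three <|
    and (relAt ?_ ?_ ?_ ?_ ?_) (relAt ?_ ?_ ?_ ?_ ?_)))
  all_goals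
    repeat
      first
      | exact snd
      | exact hn.reindex _
      | exact hM.reindex _
      | apply skip

theorem refine_iterate {M : ∀ i, ColorRel (n i)} {R : ι → ℕ}
    (hn : PolyComp n x (fun i => ofNat (n i)))
    (hM : PolyComp n x (fun i => ofColorRel (M i))) (hR : PolyComp n x (fun i => ofNat (R i)))
    (hb : PolyBd n (fun _ => 1) (fun i => R i)) :
    PolyComp n x (fun i => ofColorRel (refineRel^[R i] (M i))) := by
  refine (Comp.countdown (s := fun i j => ofColorRel (refineRel^[R i - j] (M i))) hR hb
    (fun _ => le_rfl) (hM.congr fun i => by simp) ?_).congr fun i => by simp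
  refine (refine (fst.seq (skip (hn.reindex _))) snd).congr fun p => ?_
  rw [← Function.iterate_succ_apply' refineRel]
  congr 2
  omega

theorem consistent {G : ∀ i, SimpleGraph (Fin (n i))} {τ : ∀ i, Fin (n i) → Fin 4}
    {a b : ∀ i, Fin (n i)} (hn : PolyComp n x (fun i => ofNat (n i)))
    (hG : PolyComp n x (fun i => ofGraph (G i)))
    (hτ : PolyComp n x (fun i => SExp.tab fun v => ofNat (τ i v)))
    (ha : PolyComp n x (fun i => ofNat (a i))) (hb : PolyComp n x (fun i => ofNat (b i))) :
    PolyComp n x (fun i => ofProp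
      (∀ v, ∃ z, refineRel^[3 * n i * (3 * n i)] (initRel (G i) (τ i) (a i) (b i)) v z v z)) := by
  have h3n : PolyComp n x (fun i => ofNat (3 * n i)) := mul three hn bound_three .self
  have h3b : PolyBd n (fun _ => 1) (fun i => (3 * n i : ℕ)) := by
    simpa using bound_three.mul (.self (n := n))
  have h9b : PolyBd n (fun _ => 1) (fun i => (3 * n i * (3 * n i) : ℕ)) := by
    simpa using h3b.mul h3b
  -- The table is computed once and stored before the vertices are inspected.
  refine Comp.seq (Comp.cons id (refine_iterate hn (init hn hG hτ ha hb)
    (mul h3n h3n h3b h3b) h9b)) ?_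
  exact all (skip hn) .self (any three bound_three (relAt (skip (skip snd)) (skip snd) snd
    (skip snd) snd))

/-- The test for one prescription of colours takes polynomial time. -/
theorem accepts {G : ∀ i, SimpleGraph (Fin (n i))} {τ : ∀ i, Fin (n i) → Fin 4}
    (hn : PolyComp n x (fun i => ofNat (n i))) (hG : PolyComp n x (fun i => ofGraph (G i)))
    (hτ : PolyComp n x (fun i => SExp.tab fun v => ofNat (τ i v))) :
    PolyComp n x (fun i => ofProp (Accepts (G i) (τ i))) :=
  any hn .self <| any (skip (hn.reindex _)) .self <|
    consistent (skip (skip (hn.reindex _))) (skip (skip (hG.reindex _)))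
      (skip (skip (hτ.reindex _))) (skip snd) snd

end PolyComp

/-! ### Branching over the deletion set -/

open Classical in
/-- Put in front of `c` all prescriptions for one further vertex: the three colours if the vertex is
in the deletion set, and none (the value `3`) otherwise. -/
noncomputable def branchStep (b : Prop) (acc : List (List (Fin 4))) (c : List (Fin 4)) :
    List (List (Fin 4)) :=
  if b then (0 :: c) :: (1 :: c) :: (2 :: c) :: acc else (3 :: c) :: acc

/-- All prescriptions of colours for the vertices in the deletion set, which is given by its
characteristic vector. -/
noncomputable def branch : List Prop → List (List (Fin 4))
  | [] => [[]]
  | b :: bs => (branch bs).foldl (branchStep b) []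

theorem mem_foldl_branchStep {b : Prop} {l acc : List (List (Fin 4))} {d : List (Fin 4)} :
    d ∈ l.foldl (branchStep b) acc ↔ d ∈ acc ∨ ∃ c ∈ l, ∃ t : Fin 4, (b ↔ t ≠ 3) ∧ d = t :: c := by
  induction l generalizing acc with
  | nil => simp
  | cons c l ih =>
    rw [List.foldl_cons, ih]
    by_cases h : b
    · simp only [branchStep, h, if_true, List.mem_cons, exists_eq_or_imp, true_iff]
      rw [show (∃ t : Fin 4, t ≠ 3 ∧ d = t :: c) ↔ d = 0 :: c ∨ d = 1 :: c ∨ d = 2 :: c by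
        simp [Fin.exists_fin_succ]]
      tauto
    · simp only [branchStep, h, if_false, List.mem_cons, exists_eq_or_imp, false_iff, not_not,
        exists_eq_left, ne_eq]
      tauto

theorem mem_branch {bs : List Prop} {c : List (Fin 4)} :
    c ∈ branch bs ↔ List.Forall₂ (fun (b : Prop) (t : Fin 4) => b ↔ t ≠ 3) bs c := by
  induction bs generalizing c with
  | nil => simp [branch]
  | cons b bs ih =>
    simp only [branch, mem_foldl_branchStep, List.not_mem_nil, false_or, List.forall₂_cons_left_iff,
      ih]
    constructor
    · rintro ⟨c, hc, t, ht, rfl⟩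
      exact ⟨t, c, ht, hc, rfl⟩
    · rintro ⟨t, c, ht, hc, rfl⟩
      exact ⟨c, hc, t, ht, rfl⟩

theorem mem_branch_ofFn {n : ℕ} {P : Fin n → Prop} {c : List (Fin 4)} :
    c ∈ branch (List.ofFn P) ↔ c.length = n ∧ ∀ v : Fin n, P v ↔ c.getD v 3 ≠ 3 := by
  rw [mem_branch, List.forall₂_iff_get]
  simp only [List.length_ofFn, List.get_eq_getElem, List.getElem_ofFn]
  constructor
  · rintro ⟨h, h'⟩
    refine ⟨h.symm, fun v => ?_⟩
    rw [List.getD_eq_getElem _ _ (h ▸ v.2)]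
    exact h' v v.2 (h ▸ v.2)
  · rintro ⟨h, h'⟩
    refine ⟨h.symm, fun v hv hv' => ?_⟩
    rw [h' ⟨v, hv⟩, List.getD_eq_getElem _ _ hv']

open Classical in
theorem length_branch (bs : List Prop) :
    (branch bs).length = 3 ^ (bs.countP fun b => decide b) := by
  have h : ∀ (b : Prop) (l acc : List (List (Fin 4))),
      (l.foldl (branchStep b) acc).length = acc.length + l.length * if b then 3 else 1 := by
    intro b l
    induction l with
    | nil => simp
    | cons c l ih =>
      intro acc
      rw [List.foldl_cons, ih]
      by_cases hb : b
      · simp [branchStep, hb]; ring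
      · simp [branchStep, hb]; ring
  induction bs with
  | nil => rfl
  | cons b bs ih =>
    rw [branch, h, ih]
    by_cases hb : b <;> simp [hb, pow_succ]

open Classical in
/-- A deletion set of size `ℓ` gives rise to at most `3 ^ ℓ` prescriptions, also while the list of
prescriptions is built up from the last vertex. -/
theorem length_branch_drop_le {n : ℕ} (X : Finset (Fin n)) (j : ℕ) :
    (branch ((List.ofFn fun v => v ∈ X).drop j)).length ≤ 3 ^ X.card := by
  rw [length_branch]
  refine Nat.pow_le_pow_right (by norm_num) ((List.drop_sublist _ _).countP_le.trans ?_)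
  rw [List.ofFn_eq_map, List.countP_map, List.countP_eq_length_filter,
    ← List.toFinset_card_of_nodup ((List.nodup_finRange n).filter _)]
  exact Finset.card_le_card fun v hv => by simpa using hv

namespace SExp

/-- The representation of a prescription. -/
def ofColors (c : List (Fin 4)) : SExp :=
  ofList (c.map fun t : Fin 4 => ofNat t)

/-- The representation of a list of prescriptions. -/
def ofBranches (L : List (List (Fin 4))) : SExp :=
  ofList (L.map ofColors)

end SExp

section Branching

variable {ι : Type} {n l : ι → ℕ} {x : ι → SExp}

theorem PolyComp.mem {X : ∀ i, Finset (Fin (n i))} {v : ∀ i, Fin (n i)}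
    (hX : PolyComp n x (fun i => ofVertexSet (X i))) (hv : PolyComp n x (fun i => ofNat (v i))) :
    PolyComp n x (fun i => ofProp (v i ∈ X i)) :=
  get (g := fun i v => ofProp (v ∈ X i)) hX hv .self

theorem PolyComp.branchStep {b : ι → Prop} {acc : ι → List (List (Fin 4))} {c : ι → List (Fin 4)}
    (hb : PolyComp n x (fun i => ofProp (b i))) (hacc : PolyComp n x (fun i => ofBranches (acc i)))
    (hc : PolyComp n x (fun i => ofColors (c i))) :
    PolyComp n x (fun i => ofBranches (_root_.branchStep (b i) (acc i) (c i))) := by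
  have push : ∀ (t : Fin 4) {L : ι → List (List (Fin 4))},
      PolyComp n x (fun i => ofBranches (L i)) →
      PolyComp n x (fun i => ofBranches ((t :: c i) :: L i)) :=
    fun t L hL => Comp.cons (Comp.cons (const (ofNat t)) hc) hL
  refine (hb.ite (push 0 (push 1 (push 2 hacc))) (push 3 hacc)).congr fun i => ?_
  rw [_root_.branchStep]
  split_ifs <;> rfl

/-- The list of all prescriptions is computed in time `3 ^ ℓ`, up to a polynomial factor. -/
theorem Comp.branch {X : ∀ i, Finset (Fin (n i))} (hn : PolyComp n x (fun i => ofNat (n i)))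
    (hX : PolyComp n x (fun i => ofVertexSet (X i))) (hl : ∀ i, (X i).card = l i) :
    Comp n (fun i => 3 ^ l i) x (fun i => ofBranches (branch (List.ofFn fun v => v ∈ X i))) := by
  have hw : ∀ i, (1 : ℝ≥0) ≤ 3 ^ l i := fun i => one_le_pow₀ (by norm_num)
  refine (countdown (s := fun i j =>
    ofBranches (_root_.branch ((List.ofFn fun v => v ∈ X i).drop j))) (hn.mono hw) .self
    hw ?_ ?_).congr fun i => by simp
  · refine (const (ofBranches [[]]) hw).congr fun i => ?_
    rw [List.drop_eq_nil_of_le (by simp), _root_.branch]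
  · set L : (Σ i, Fin (n i)) → List (List (Fin 4)) :=
      fun p => _root_.branch ((List.ofFn fun v => v ∈ X p.1).drop (p.2 + 1)) with hL
    have hw' : ∀ p : Σ i, Fin (n i), (1 : ℝ≥0) ≤ 3 ^ l p.1 := fun p => hw p.1
    refine (fold (w₁ := fun _ => 1) (w₂ := fun p => 3 ^ l p.1) (l := fun p => (L p).map ofColors)
      (s := fun p k => ofBranches (((L p).take k).foldl (_root_.branchStep (p.2 ∈ X p.1)) []))
      (snd hw') (const (ofBranches []) hw') ?_ ?_ (fun _ => le_rfl) (by simp) hw').congr fun p => ?_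
    · have hk : ∀ q : Σ p, Fin ((L p).map ofColors).length, (q.2 : ℕ) < (L q.1).length :=
        fun q => q.2.2.trans_eq (List.length_map _)
      refine (PolyComp.branchStep (b := fun q => q.1.2 ∈ X q.1.1)
        (c := fun q => (L q.1)[(q.2 : ℕ)]'(hk q)) ?_ PolyComp.snd ?_).congr fun q => ?_
      · exact .skip <| .skip <| .skip <| .mem (.skip (hX.reindex _)) .snd
      · refine PolyComp.skip (ofList_head PolyComp.snd (fun q => ?_) fun _ => le_rfl)
        simp [hk q]
      · rw [← List.take_concat_get' _ _ (hk q), List.foldl_append]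
        rfl
    · refine ⟨1, 0, fun p => ?_⟩
      simp only [List.length_map, pow_zero, mul_one, Nat.cast_one, one_mul]
      have := length_branch_drop_le (X p.1) (p.2 + 1)
      rw [hl] at this
      exact_mod_cast this
    · have := List.drop_eq_getElem_cons (l := List.ofFn fun v => v ∈ X p.1) (i := p.2) (by simp)
      rw [this, _root_.branch]
      simp [hL]

/-- The tests of all prescriptions in a list of length at most `3 ^ ℓ`. -/
theorem Comp.exists_accepts {G : ∀ i, SimpleGraph (Fin (n i))} {L : ι → List (List (Fin 4))}
    (hn : PolyComp n x (fun i => ofNat (n i))) (hG : PolyComp n x (fun i => ofGraph (G i)))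
    (hL : Comp n (fun i => 3 ^ l i) x (fun i => ofBranches (L i)))
    (hlen : ∀ i, ∀ c ∈ L i, c.length = n i) (hl : ∀ i, (L i).length ≤ 3 ^ l i) :
    Comp n (fun i => 3 ^ l i) x
      (fun i => ofProp (∃ c ∈ L i, Accepts (G i) fun v => c.getD v 3)) := by
  have hw : ∀ i, (1 : ℝ≥0) ≤ 3 ^ l i := fun i => one_le_pow₀ (by norm_num)
  refine (fold (w₁ := fun _ => 1) (w₂ := fun i => 3 ^ l i) (l := fun i => (L i).map ofColors)
    (s := fun i k => ofProp (∃ c ∈ (L i).take k, Accepts (G i) fun v => c.getD v 3))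
    hL ((const .nil hw).congr fun i => (ofProp_of_not (by simp)).symm) ?_ ?_ (fun _ => le_rfl)
    (by simp) hw).congr fun i => by simp
  · have hk : ∀ q : Σ p, Fin ((L p).map ofColors).length, (q.2 : ℕ) < (L q.1).length :=
      fun q => q.2.2.trans_eq (List.length_map _)
    have hτ : PolyComp (fun q : Σ p, Fin ((L p).map ofColors).length => n q.1)
        (fun q => .cons (x q.1) (.ofList (((L q.1).map ofColors).drop q.2)))
        (fun q => .tab fun v : Fin (n q.1) => ofNat (((L q.1)[(q.2 : ℕ)]'(hk q)).getD v 3)) := by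
      refine (ofList_head PolyComp.snd (a := fun q => ofColors ((L q.1)[(q.2 : ℕ)]'(hk q)))
        (fun q => ?_) fun _ => le_rfl).congr fun q => ?_
      · simp [hk q]
      · have := hlen q.1 _ (List.getElem_mem (hk q))
        rw [ofColors, SExp.tab]
        congr 1
        refine List.ext_getElem (by simp [this]) fun v h₁ h₂ => ?_
        rw [List.length_map] at h₁
        rw [List.getElem_map, List.getElem_ofFn, List.getD_eq_getElem _ _ h₁]
    have htest := PolyComp.accepts (.skip (hn.reindex Sigma.fst)) (.skip (hG.reindex Sigma.fst)) hτ
    refine (PolyComp.or (.skip htest) .snd).congr fun q => ofProp_congr ?_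
    rw [← List.take_concat_get' _ _ (hk q)]
    simp only [List.mem_append, List.mem_singleton, or_and_right, exists_or, exists_eq_left]
    exact or_comm
  · refine ⟨1, 0, fun i => ?_⟩
    simp only [List.length_map, pow_zero, mul_one, Nat.cast_one, one_mul]
    exact_mod_cast hl i

end Branching

/-! ### Simplicial vertices of chordal graphs -/

namespace SimpleGraph

variable {V : Type*} {H : SimpleGraph V}

theorem cycleGraph_adj_iff_val {m : ℕ} (hm : 2 ≤ m) {i j : Fin m} :
    (cycleGraph m).Adj i j ↔ (i : ℕ) = j + 1 ∨ (j : ℕ) = i + 1 ∨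
      (i : ℕ) = 0 ∧ (j : ℕ) + 1 = m ∨ (j : ℕ) = 0 ∧ (i : ℕ) + 1 = m := by
  rw [cycleGraph_adj']
  have hi := i.2
  have hj := j.2
  rcases lt_trichotomy (i : ℕ) j with h | h | h
  · rw [Fin.coe_sub_iff_lt.mpr (Fin.lt_def.mpr h), Fin.sub_val_of_le (Fin.le_def.mpr h.le)]
    omega
  · obtain rfl := Fin.ext h
    rw [Fin.sub_val_of_le le_rfl]
    omega
  · rw [Fin.coe_sub_iff_lt.mpr (Fin.lt_def.mpr h), Fin.sub_val_of_le (Fin.le_def.mpr h.le)]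
    omega

/-- A shortest path between `s` and `s'` through `S` closes up, with a vertex `d` whose only
neighbours in `S` are `s` and `s'`, to an induced cycle. Therefore the path has a single edge if the
graph is chordal. -/
theorem IsChordal.adj_of_reachable (hH : H.IsChordal) {S : Set V} {s s' : S} {d : V}
    (hss : (H.induce S).Reachable s s') (hd : d ∉ S) (hds : H.Adj d s) (hds' : H.Adj d s')
    (hdS : ∀ x : S, H.Adj d x → x = s ∨ x = s') (hne : s ≠ s') : H.Adj s s' := by
  by_contra hadj
  have hL := hss.one_lt_dist_of_ne_of_not_adj hne hadj
  obtain ⟨p, hp⟩ := hss.exists_walk_length_eq_dist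
  rw [← hp] at hL
  have hdist : ∀ i ≤ p.length, (H.induce S).dist s (p.getVert i) = i := fun i hi => by
    rw [← length_eq_dist_of_subwalk hp (p.isSubwalk_take i), p.take_length, min_eq_left hi]
  let f : Fin (p.length + 2) → V := fun i => if (i : ℕ) ≤ p.length then p.getVert i else d
  have hfp : ∀ i : Fin (p.length + 2), (i : ℕ) ≤ p.length → f i = p.getVert i := fun i hi => by
    simp [f, hi]
  have hfd : ∀ i : Fin (p.length + 2), ¬ (i : ℕ) ≤ p.length → f i = d := fun i hi => by
    simp [f, hi]
  have hinj : ∀ i j, i ≤ p.length → j ≤ p.length → p.getVert i = p.getVert j → i = j :=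
    fun i j hi hj h => by rw [← hdist i hi, ← hdist j hj, h]
  have hpadj : ∀ i j, i ≤ p.length → j ≤ p.length →
      (H.Adj (p.getVert i) (p.getVert j) ↔ i = j + 1 ∨ j = i + 1) := fun i j hi hj => by
    constructor
    · intro h
      have hne : i ≠ j := by
        rintro rfl
        exact h.ne rfl
      have := Adj.diff_dist_adj (u := s) (show (H.induce S).Adj _ _ from h)
      rw [hdist i hi, hdist j hj] at this
      omega
    · rintro (rfl | rfl)
      · exact (p.adj_getVert_succ (i := j) (by omega)).symm
      · exact p.adj_getVert_succ (i := i) (by omega)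
  have hdadj : ∀ i ≤ p.length, (H.Adj d (p.getVert i) ↔ i = 0 ∨ i = p.length) := fun i hi => by
    constructor
    · intro h
      rcases hdS _ h with h | h
      · exact .inl (hinj _ _ hi (by omega) (by simpa using h))
      · exact .inr (hinj _ _ hi le_rfl (by simpa using h))
    · rintro (rfl | rfl) <;> simpa
  have hfinj : Function.Injective f := by
    intro i j h
    by_cases hi : (i : ℕ) ≤ p.length <;> by_cases hj : (j : ℕ) ≤ p.length
    · rw [hfp i hi, hfp j hj] at h
      exact Fin.ext (hinj _ _ hi hj (Subtype.ext h))
    · rw [hfp i hi, hfd j hj] at h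
      exact absurd (h ▸ (p.getVert i).2) hd
    · rw [hfd i hi, hfp j hj] at h
      exact absurd (h ▸ (p.getVert j).2) hd
    · exact Fin.ext (by omega)
  have hfadj : ∀ {i j}, H.Adj (f i) (f j) ↔ (cycleGraph (p.length + 2)).Adj i j := by
    intro i j
    rw [cycleGraph_adj_iff_val (by omega)]
    by_cases hi : (i : ℕ) ≤ p.length <;> by_cases hj : (j : ℕ) ≤ p.length
    · rw [hfp i hi, hfp j hj, hpadj _ _ hi hj]
      omega
    · rw [hfp i hi, hfd j hj, adj_comm, hdadj _ hi]
      omega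
    · rw [hfd i hi, hfp j hj, hdadj _ hj]
      omega
    · rw [hfd i hi, hfd j hj]
      simp only [SimpleGraph.irrefl, false_iff]
      omega
  have := hH (p.length + 2) (by omega) ⟨⟨⟨f, hfinj⟩, hfadj⟩⟩
  omega

/-- Every nonempty induced subgraph of a chordal graph has a simplicial vertex. Unless `W` is a
clique, take a maximal connected `T ⊆ W` that does not dominate `W`, and let `D` be the set of the
vertices in `W` that `T` does not dominate. By maximality, each vertex of `W` outside `T` with a
neighbour in `T` is adjacent to all of `D`; these vertices form a clique, as the graph is chordal.
So a simplicial vertex of `D` is simplicial in `W`. -/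
theorem IsChordal.exists_simplicial (hH : H.IsChordal) (W : Finset V) (hW : W.Nonempty) :
    ∃ v ∈ W, ∀ x ∈ W, ∀ y ∈ W, H.Adj v x → H.Adj v y → x ≠ y → H.Adj x y := by
  classical
  induction W using Finset.strongInduction with
  | H W ih =>
  by_cases hclique : ∀ x ∈ W, ∀ y ∈ W, x ≠ y → H.Adj x y
  · obtain ⟨v, hv⟩ := hW
    exact ⟨v, hv, fun x hx y hy _ _ hxy => hclique x hx y hy hxy⟩
  push Not at hclique
  obtain ⟨t, ht, u, hu, htu, hadj⟩ := hclique
  let D : Finset V → Finset V := fun T => {d ∈ W | d ∉ T ∧ ∀ x ∈ T, ¬ H.Adj x d}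
  let F : Finset (Finset V) :=
    {T ∈ W.powerset | (H.induce (T : Set V)).Connected ∧ (D T).Nonempty}
  have hF : F.Nonempty := by
    refine ⟨{t}, ?_⟩
    simp only [F, Finset.mem_filter, Finset.mem_powerset, Finset.singleton_subset_iff]
    refine ⟨ht, ?_, u, ?_⟩
    · rw [Finset.coe_singleton]
      have : Nonempty (({t} : Set V) : Type _) := ⟨⟨t, rfl⟩⟩
      exact ⟨fun a b => by rw [Subsingleton.elim a b]⟩
    · simp [D, hu, htu.symm, hadj]
  obtain ⟨T, hTF, hTmax⟩ := F.exists_max_image Finset.card hF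
  simp only [F, Finset.mem_filter, Finset.mem_powerset] at hTF hTmax
  obtain ⟨hTW, hTconn, hD⟩ := hTF
  have hN : ∀ s ∈ W, s ∉ T → s ∉ D T → (∃ x ∈ T, H.Adj x s) ∧ ∀ d ∈ D T, H.Adj s d := by
    intro s hs hsT hsD
    have hx : ∃ x ∈ T, H.Adj x s := by
      by_contra! h
      exact hsD (by simpa [D, hs, hsT] using h)
    refine ⟨hx, fun d hd => ?_⟩
    by_contra hsd
    obtain ⟨x, hxT, hxs⟩ := hx
    have hd' := hd
    simp only [D, Finset.mem_filter] at hd'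
    have hsd' : s ≠ d := by
      rintro rfl
      exact hsD hd
    have := hTmax (insert s T) ⟨Finset.insert_subset hs hTW, ?_, d, ?_⟩
    · rw [Finset.card_insert_of_notMem hsT] at this
      omega
    · rw [Finset.coe_insert]
      have h1 : (H.induce ({s} : Set V)).Connected := by
        have : Nonempty (({s} : Set V) : Type _) := ⟨⟨s, rfl⟩⟩
        exact ⟨fun a b => by rw [Subsingleton.elim a b]⟩
      exact connected_induce_union h1.preconnected hTconn.preconnected rfl hxT hxs.symm
    · simp only [D, Finset.mem_filter, Finset.mem_insert, not_or, forall_eq_or_imp]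
      exact ⟨hd'.1, ⟨hsd'.symm, hd'.2.1⟩, hsd, hd'.2.2⟩
  obtain ⟨v, hv, hsimp⟩ := ih (D T) (by
    refine (Finset.filter_subset _ _).ssubset_of_ne fun h => ?_
    obtain ⟨⟨x, hx⟩⟩ := hTconn.nonempty
    have : x ∈ D T := by
      rw [show D T = W from h]
      exact hTW hx
    exact (Finset.mem_filter.mp this).2.1 hx) hD
  have hv' := Finset.mem_filter.mp hv
  have hvT : ∀ x, H.Adj v x → x ∉ T := fun x hx hxT => hv'.2.2 x hxT hx.symm
  refine ⟨v, hv'.1, fun x hx y hy hvx hvy hxy => ?_⟩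
  by_cases hxD : x ∈ D T <;> by_cases hyD : y ∈ D T
  · exact hsimp x hxD y hyD hvx hvy hxy
  · exact ((hN y hy (hvT y hvy) hyD).2 x hxD).symm
  · exact (hN x hx (hvT x hvx) hxD).2 y hyD
  · obtain ⟨a, ha, hax⟩ := (hN x hx (hvT x hvx) hxD).1
    obtain ⟨b, hb, hby⟩ := (hN y hy (hvT y hvy) hyD).1
    have h1 : ∀ z : V, (H.induce ({z} : Set V)).Preconnected := fun z a b => by
      rw [Subsingleton.elim a b]
    have hconn : (H.induce ({x} ∪ ({y} ∪ (T : Set V)))).Connected :=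
      connected_induce_union (h1 x) (connected_induce_union (h1 y) hTconn.preconnected rfl hb
        hby.symm).preconnected rfl (.inr ha) hax.symm
    refine hH.adj_of_reachable (s := ⟨x, .inl rfl⟩) (s' := ⟨y, .inr (.inl rfl)⟩) (d := v)
      (hconn.preconnected _ _) ?_ hvx hvy ?_ (fun h => hxy (congrArg Subtype.val h))
    · rintro (h | h | h)
      · exact hvx.ne h
      · exact hvy.ne h
      · exact hv'.2.1 h
    · rintro ⟨z, h | h | h⟩ hvz
      · exact .inl (Subtype.ext h)
      · exact .inr (Subtype.ext h)
      · exact absurd h (hvT z hvz)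

end SimpleGraph

/-! ### Correctness of path consistency -/

theorem refineRel_le {n : ℕ} (M : ColorRel n) : refineRel M ≤ M :=
  fun _ _ _ _ h => h.1

theorem iterate_refineRel_le {n : ℕ} (M : ColorRel n) (k : ℕ) : refineRel^[k] M ≤ M := by
  induction k with
  | zero => exact le_rfl
  | succ k ih =>
    rw [Function.iterate_succ_apply']
    exact (refineRel_le _).trans ih

theorem iterate_refineRel_symm {n : ℕ} {M : ColorRel n}
    (hM : ∀ u x v y, M u x v y → M v y u x) (k : ℕ) (u : Fin n) (x : Fin 3) (v : Fin n)
    (y : Fin 3) (h : refineRel^[k] M u x v y) : refineRel^[k] M v y u x := by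
  induction k generalizing u x v y with
  | zero => exact hM _ _ _ _ h
  | succ k ih =>
    rw [Function.iterate_succ_apply'] at h ⊢
    refine ⟨ih _ _ _ _ h.1, fun w => ?_⟩
    obtain ⟨z, hz, hz'⟩ := h.2 w
    exact ⟨z, ih _ _ _ _ hz', ih _ _ _ _ hz⟩

/-- Path consistency never excludes a solution. -/
theorem iterate_refineRel_of_solution {n : ℕ} {M : ColorRel n} {φ : Fin n → Fin 3}
    (hφ : ∀ u v, M u (φ u) v (φ v)) (k : ℕ) (u v : Fin n) :
    refineRel^[k] M u (φ u) v (φ v) := by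
  induction k generalizing u v with
  | zero => exact hφ u v
  | succ k ih =>
    rw [Function.iterate_succ_apply']
    exact ⟨ih u v, fun w => ⟨φ w, ih u w, ih w v⟩⟩

/-- Each round that changes something excludes a pair, so the process becomes stationary. -/
theorem refineRel_iterate_eq {n : ℕ} (M : ColorRel n) :
    refineRel (refineRel^[3 * n * (3 * n)] M) = refineRel^[3 * n * (3 * n)] M := by
  classical
  let pairs : ColorRel n → Finset ((Fin n × Fin 3) × Fin n × Fin 3) := fun M =>
    {q | M q.1.1 q.1.2 q.2.1 q.2.2}
  have hlt : ∀ M, refineRel M ≠ M → (pairs (refineRel M)).card < (pairs M).card := by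
    intro M hM
    refine Finset.card_lt_card ⟨fun q hq => ?_, fun h => hM ?_⟩
    · simp only [pairs, Finset.mem_filter_univ] at hq ⊢
      exact hq.1
    · refine le_antisymm (refineRel_le M) fun u x v y huv => ?_
      have := @h ((u, x), v, y)
      simp only [pairs, Finset.mem_filter_univ] at this
      exact this huv
  have key : ∀ k, refineRel (refineRel^[k] M) = refineRel^[k] M ∨
      (pairs (refineRel^[k] M)).card + k ≤ 3 * n * (3 * n) := by
    intro k
    induction k with
    | zero =>
      refine .inr ((Finset.card_le_univ _).trans_eq ?_)
      simp only [Fintype.card_prod, Fintype.card_fin]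
      ring
    | succ k ih =>
      rw [Function.iterate_succ_apply']
      by_cases h : refineRel (refineRel^[k] M) = refineRel^[k] M
      · exact .inl (by rw [h, h])
      · have := hlt _ h
        rcases ih with ih | ih
        · exact absurd ih h
        · exact .inr (by omega)
  rcases key (3 * n * (3 * n)) with h | h
  · exact h
  · by_contra hne
    have := hlt _ hne
    omega

/-- The extension step. The vertices in `K` form a clique and have pairwise compatible colours `c`;
`B z u` says that the colour `z` of a further vertex that is adjacent to all of `K` is consistent
with the colour of `u`. If every pair of vertices in `K` leaves a colour then so does `K`. The
colours in `K` are, up to one `2`, all `0` or all `1`, which is why three vertices that block a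
colour each can be replaced by two. -/
theorem exists_color_of_pairwise {α : Type*} {K : Set α} {c : α → Fin 3} {B : Fin 3 → α → Prop}
    (hpair : ∀ u ∈ K, ∀ v ∈ K, ∃ z, B z u ∧ B z v) (hB : ∀ u ∈ K, ∀ z, B z u → Compat (c u) z)
    (hc : ∀ u ∈ K, ∀ v ∈ K, u ≠ v → Compat (c u) (c v)) : ∃ z, ∀ u ∈ K, B z u := by
  by_contra! h
  obtain ⟨u₀, h₀, hu₀⟩ := h 0
  obtain ⟨u₁, h₁, hu₁⟩ := h 1
  obtain ⟨u₂, h₂, hu₂⟩ := h 2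
  have hcol : ∀ t : Fin 3, t = 0 ∨ t = 1 ∨ t = 2 := by decide
  have contra : ∀ u ∈ K, ∀ v ∈ K, (∀ z, ¬ B z u ∨ ¬ B z v) → False := by
    intro u hu v hv h
    obtain ⟨z, hz, hz'⟩ := hpair u hu v hv
    exact (h z).elim (· hz) (· hz')
  have b01 : ∀ u ∈ K, c u = 0 → ¬ B 1 u := fun u hu hcu hb => (hB u hu 1 hb).1 ⟨hcu, rfl⟩
  have b10 : ∀ u ∈ K, c u = 1 → ¬ B 0 u := fun u hu hcu hb => (hB u hu 0 hb).2.1 ⟨hcu, rfl⟩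
  have b22 : ∀ u ∈ K, c u = 2 → ¬ B 2 u := fun u hu hcu hb => (hB u hu 2 hb).2.2 ⟨hcu, rfl⟩
  have two : ∀ u ∈ K, ∀ v ∈ K, c u = 2 → c v = 2 → u = v := by
    intro u hu v hv h h'
    by_contra hne
    exact (hc u hu v hv hne).2.2 ⟨h, h'⟩
  have notBoth : ∀ u ∈ K, ∀ v ∈ K, c u = 0 → c v ≠ 1 := by
    intro u hu v hv h h'
    refine (hc u hu v hv ?_).1 ⟨h, h'⟩
    rintro rfl
    simp [h] at h'
  by_cases hzero : ∃ u ∈ K, c u = 0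
  · obtain ⟨u, hu, hcu⟩ := hzero
    rcases hcol (c u₀) with h | h | h
    · exact contra u₀ h₀ u₂ h₂ (Fin.forall_fin_succ.mpr ⟨.inl hu₀, Fin.forall_fin_two.mpr
        ⟨.inl (b01 _ h₀ h), .inr hu₂⟩⟩)
    · exact notBoth u hu u₀ h₀ hcu h
    · rcases hcol (c u₂) with h' | h' | h'
      · exact contra u₀ h₀ u₂ h₂ (Fin.forall_fin_succ.mpr ⟨.inl hu₀, Fin.forall_fin_two.mpr
          ⟨.inr (b01 _ h₂ h'), .inr hu₂⟩⟩)
      · exact notBoth u hu u₂ h₂ hcu h'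
      · obtain rfl := two _ h₀ _ h₂ h h'
        exact contra u₀ h₀ u hu (Fin.forall_fin_succ.mpr ⟨.inl hu₀, Fin.forall_fin_two.mpr
          ⟨.inr (b01 _ hu hcu), .inl hu₂⟩⟩)
  by_cases hone : ∃ u ∈ K, c u = 1
  · obtain ⟨u, hu, hcu⟩ := hone
    rcases hcol (c u₁) with h | h | h
    · exact hzero ⟨u₁, h₁, h⟩
    · exact contra u₁ h₁ u₂ h₂ (Fin.forall_fin_succ.mpr ⟨.inl (b10 _ h₁ h),
        Fin.forall_fin_two.mpr ⟨.inl hu₁, .inr hu₂⟩⟩)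
    · rcases hcol (c u₂) with h' | h' | h'
      · exact hzero ⟨u₂, h₂, h'⟩
      · exact contra u₁ h₁ u₂ h₂ (Fin.forall_fin_succ.mpr ⟨.inr (b10 _ h₂ h'),
          Fin.forall_fin_two.mpr ⟨.inl hu₁, .inr hu₂⟩⟩)
      · obtain rfl := two _ h₁ _ h₂ h h'
        exact contra u₁ h₁ u hu (Fin.forall_fin_succ.mpr ⟨.inr (b10 _ hu hcu),
          Fin.forall_fin_two.mpr ⟨.inl hu₁, .inl hu₂⟩⟩)
  · have all2 : ∀ u ∈ K, c u = 2 := fun u hu => by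
      rcases hcol (c u) with h | h | h
      · exact absurd ⟨u, hu, h⟩ hzero
      · exact absurd ⟨u, hu, h⟩ hone
      · exact h
    obtain rfl := two _ h₀ _ h₁ (all2 _ h₀) (all2 _ h₁)
    obtain rfl := two _ h₀ _ h₂ (all2 _ h₀) (all2 _ h₂)
    exact contra u₀ h₀ u₀ h₀ (Fin.forall_fin_succ.mpr ⟨.inl hu₀, Fin.forall_fin_two.mpr
      ⟨.inl hu₁, .inl hu₂⟩⟩)

/-- On a chordal graph, path consistency with a colour left for each vertex ensures a solution: the
vertices are coloured along a perfect elimination ordering, in reverse. -/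
theorem SimpleGraph.IsChordal.exists_coloring {V : Type*} {H : SimpleGraph V} (hH : H.IsChordal)
    {M : V → Fin 3 → V → Fin 3 → Prop} (hsymm : ∀ u x v y, M u x v y → M v y u x)
    (hext : ∀ u x v y w, M u x v y → ∃ z, M u x w z ∧ M w z v y)
    (hdiag : ∀ u x y, M u x u y → x = y)
    (hadj : ∀ u x v y, M u x v y → H.Adj u v → Compat x y) (hne : ∀ v, ∃ z, M v z v z)
    (W : Finset V) : ∃ φ : V → Fin 3, (∀ u ∈ W, M u (φ u) u (φ u)) ∧
      ∀ u ∈ W, ∀ v ∈ W, H.Adj u v → M u (φ u) v (φ v) := by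
  classical
  induction W using Finset.strongInduction with
  | H W ih =>
  rcases W.eq_empty_or_nonempty with rfl | hW
  · exact ⟨fun _ => 0, by simp, by simp⟩
  obtain ⟨v, hv, hsimp⟩ := hH.exists_simplicial W hW
  obtain ⟨φ, hφ, hφadj⟩ := ih (W.erase v) (Finset.erase_ssubset hv)
  let K : Set V := {u | u ∈ W ∧ H.Adj v u}
  have hK : ∀ u ∈ K, u ∈ W.erase v := fun u hu => Finset.mem_erase.mpr ⟨hu.2.ne', hu.1⟩
  have hKM : ∀ u ∈ K, ∀ u' ∈ K, M u (φ u) u' (φ u') := by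
    intro u hu u' hu'
    by_cases h : u = u'
    · exact h ▸ hφ u (hK u hu)
    · exact hφadj u (hK u hu) u' (hK u' hu') (hsimp u hu.1 u' hu'.1 hu.2 hu'.2 h)
  obtain ⟨z, hz, hzK⟩ : ∃ z, M v z v z ∧ ∀ u ∈ K, M u (φ u) v z := by
    rcases K.eq_empty_or_nonempty with hempty | ⟨u, hu⟩
    · obtain ⟨z, hz⟩ := hne v
      exact ⟨z, hz, by simp [hempty]⟩
    · obtain ⟨z, hz⟩ := exists_color_of_pairwise (K := K) (c := φ) (B := fun z u => M u (φ u) v z)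
        (fun u hu u' hu' => by
          obtain ⟨z, h, h'⟩ := hext _ _ _ _ v (hKM u hu u' hu')
          exact ⟨z, h, hsymm _ _ _ _ h'⟩)
        (fun u hu z h => hadj _ _ _ _ h hu.2.symm)
        (fun u hu u' hu' hne => hadj _ _ _ _ (hKM u hu u' hu')
          (hsimp u hu.1 u' hu'.1 hu.2 hu'.2 hne))
      obtain ⟨z', -, h⟩ := hext _ _ _ _ v (hz u hu)
      obtain rfl := hdiag _ _ _ h
      exact ⟨z', h, hz⟩
  have hupd : ∀ u ∈ W, u ≠ v → u ∈ W.erase v := fun u hu h => Finset.mem_erase.mpr ⟨h, hu⟩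
  refine ⟨Function.update φ v z, fun u hu => ?_, fun u hu u' hu' h => ?_⟩
  · by_cases huv : u = v
    · subst huv
      simpa using hz
    · simpa [huv] using hφ u (hupd u hu huv)
  · by_cases huv : u = v
    · subst huv
      rw [Function.update_self, Function.update_of_ne h.ne']
      exact hsymm _ _ _ _ (hzK u' ⟨hu', h⟩)
    · by_cases huv' : u' = v
      · subst huv'
        rw [Function.update_self, Function.update_of_ne huv]
        exact hzK u ⟨hu, h.symm⟩
      · rw [Function.update_of_ne huv, Function.update_of_ne huv']
        exact hφadj u (hupd u hu huv) u' (hupd u' hu' huv') h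

/-! ### Independent cutsets as colourings -/

theorem Compat.symm {x y : Fin 3} (h : Compat x y) : Compat y x := by
  unfold Compat at *
  tauto

theorem SimpleGraph.hasIndependentCutset_iff {V : Type*} [Finite V] {G : SimpleGraph V} :
    G.HasIndependentCutset ↔ ∃ φ : V → Fin 3, (∀ u v, G.Adj u v → Compat (φ u) (φ v)) ∧
      (∃ a, φ a = 0) ∧ ∃ b, φ b = 1 := by
  classical
  constructor
  · rintro ⟨S, hS, hcut⟩
    simp only [IsCutset, Preconnected, not_forall] at hcut
    obtain ⟨a, b, hab⟩ := hcut
    let φ : V → Fin 3 := fun v =>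
      if h : v ∈ S then 2 else if (G.induce ((S : Set V)ᶜ)).Reachable a ⟨v, h⟩ then 0 else 1
    have hφS : ∀ v, φ v = 2 ↔ v ∈ S := by
      intro v
      by_cases h : v ∈ S
      · simp [φ, h]
      · simp only [φ, h, dif_neg, not_false_iff, iff_false]
        split_ifs <;> decide
    have hφ0 : ∀ v (h : v ∉ S), φ v = 0 ↔ (G.induce ((S : Set V)ᶜ)).Reachable a ⟨v, h⟩ := by
      intro v h
      simp only [φ, h, dif_neg, not_false_iff]
      split_ifs with h' <;> simp [h']
    have hstep : ∀ u v, G.Adj u v → φ u = 0 → φ v ≠ 1 := by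
      intro u v huv hu hv
      have huS : u ∉ S := fun h => by simp [(hφS u).mpr h] at hu
      have hvS : v ∉ S := fun h => by simp [(hφS v).mpr h] at hv
      have hadj : (G.induce ((S : Set V)ᶜ)).Adj ⟨u, huS⟩ ⟨v, hvS⟩ := huv
      have := (hφ0 v hvS).mpr (((hφ0 u huS).mp hu).trans hadj.reachable)
      simp [hv] at this
    refine ⟨φ, fun u v huv => ⟨fun h => hstep u v huv h.1 h.2, fun h => hstep v u huv.symm h.2 h.1,
      fun h => hS ((hφS u).mp h.1) ((hφS v).mp h.2) huv.ne huv⟩, ⟨a, ?_⟩, ⟨b, ?_⟩⟩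
    · exact (hφ0 a a.2).mpr .rfl
    · have h0 := (hφ0 b b.2).not.mpr hab
      have h2 := (hφS b).not.mpr b.2
      revert h0 h2
      generalize φ b = t
      revert t
      decide
  · rintro ⟨φ, hφ, ⟨a, ha⟩, b, hb⟩
    have : Fintype V := Fintype.ofFinite V
    let S : Finset V := {v | φ v = 2}
    have haS : a ∈ ((S : Set V)ᶜ) := by simp [S, ha]
    have hbS : b ∈ ((S : Set V)ᶜ) := by simp [S, hb]
    refine ⟨S, ?_, fun hpre => ?_⟩
    · intro u hu v hv _ huv
      exact (hφ u v huv).2.2 ⟨by simpa [S] using hu, by simpa [S] using hv⟩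
    · have hstep : ∀ u v : ((S : Set V)ᶜ : Set V), (G.induce ((S : Set V)ᶜ)).Reachable u v →
          φ u = 0 → φ v = 0 := by
        rintro u v ⟨p⟩
        induction p with
        | nil => exact fun h => h
        | @cons u w v h p ih =>
          intro hu
          refine ih ?_
          have h1 := (hφ u w h).1
          have h2 : φ w ≠ 2 := by simpa [S] using w.2
          rw [hu] at h1
          revert h1 h2
          generalize φ (w : V) = t
          revert t
          decide
      have := hstep ⟨a, haS⟩ ⟨b, hbS⟩ (hpre _ _) ha
      simp [hb] at this

/-- The algorithm is correct: every independent cutset agrees with some prescription on `X`, and a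
prescription that is accepted extends to a colouring, because `G - X` is chordal. -/
theorem exists_accepts_iff {n : ℕ} {G : SimpleGraph (Fin n)} {X : Finset (Fin n)}
    (hX : G.IsChordalDeletion X) :
    (∃ c ∈ branch (List.ofFn fun v => v ∈ X), Accepts G fun v => c.getD v 3) ↔
      G.HasIndependentCutset := by
  classical
  rw [SimpleGraph.hasIndependentCutset_iff]
  constructor
  · rintro ⟨c, hc, a, b, hne⟩
    rw [mem_branch_ofFn] at hc
    set τ : Fin n → Fin 4 := fun v => c.getD v 3 with hτ
    set M := refineRel^[3 * n * (3 * n)] (initRel G τ a b) with hM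
    have hfix : refineRel M = M := refineRel_iterate_eq _
    have hle : ∀ u x v y, M u x v y → initRel G τ a b u x v y :=
      iterate_refineRel_le _ _
    have hsymm : ∀ u x v y, M u x v y → M v y u x := iterate_refineRel_symm
      (fun u x v y h => ⟨h.2.1, h.1, fun e => (h.2.2.1 e.symm).symm,
        fun e => (h.2.2.2 e.symm).symm⟩) _
    have hext : ∀ u x v y w, M u x v y → ∃ z, M u x w z ∧ M w z v y := by
      intro u x v y w h
      rw [← hfix] at h
      exact h.2 w
    obtain ⟨φ, hφ, hφadj⟩ := hX.exists_coloring (M := fun u x v y => M u x v y)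
      (fun u x v y => hsymm u x v y) (fun u x v y w => hext u x v y w)
      (fun u x y h => (hle _ _ _ _ h).2.2.1 rfl) (fun u x v y h => (hle _ _ _ _ h).2.2.2)
      (fun v => hne v) Finset.univ
    choose χ hχ using hne
    let ψ : Fin n → Fin 3 := fun v => if h : v ∈ X then χ v else φ ⟨v, h⟩
    have hψ : ∀ v, M v (ψ v) v (ψ v) := by
      intro v
      by_cases h : v ∈ X
      · simpa [ψ, h] using hχ v
      · simpa [ψ, h] using hφ ⟨v, h⟩ (Finset.mem_univ _)
    -- A vertex of the deletion set has only one colour left.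
    have huniq : ∀ u ∈ X, ∀ x v y, M u x v y → x = ψ u := by
      intro u hu x v y h
      have h3 : (τ u : ℕ) ≠ 3 := fun h3 => (hc.2 u).mp hu (Fin.ext h3)
      have h1 := (hle _ _ _ _ h).1.1.resolve_left h3
      have h2 := (hle _ _ _ _ (hψ u)).1.1.resolve_left h3
      exact Fin.ext (h1.symm.trans h2)
    have hXadj : ∀ u ∈ X, ∀ v, G.Adj u v → Compat (ψ u) (ψ v) := by
      intro u hu v huv
      obtain ⟨z, -, hz⟩ := hext _ _ _ _ u (hψ v)
      rw [huniq u hu z _ _ hz] at hz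
      exact (hle _ _ _ _ hz).2.2.2 huv
    refine ⟨ψ, fun u v huv => ?_, ⟨a, (hle _ _ _ _ (hψ a)).1.2.1 rfl⟩,
      b, (hle _ _ _ _ (hψ b)).1.2.2 rfl⟩
    by_cases hu : u ∈ X
    · exact hXadj u hu v huv
    · by_cases hv : v ∈ X
      · exact (hXadj v hv u huv.symm).symm
      · have := hφadj ⟨u, hu⟩ (Finset.mem_univ _) ⟨v, hv⟩ (Finset.mem_univ _) huv
        simpa [ψ, hu, hv] using (hle _ _ _ _ this).2.2.2 huv
  · rintro ⟨φ, hφ, ⟨a, ha⟩, b, hb⟩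
    let τ : Fin n → Fin 4 := fun v => if v ∈ X then (φ v).castSucc else 3
    have hτ : ∀ v : Fin n, (List.ofFn τ).getD v 3 = τ v := fun v => by
      rw [List.getD_eq_getElem _ _ (by simp), List.getElem_ofFn]
    refine ⟨List.ofFn τ, mem_branch_ofFn.mpr ⟨by simp, fun v => ?_⟩, a, b, fun v => ⟨φ v, ?_⟩⟩
    · rw [hτ]
      by_cases h : v ∈ X
      · simp only [τ, h, if_true, true_iff]
        exact (Fin.castSucc_lt_last _).ne
      · simp [τ, h]
    · simp only [hτ]
      refine iterate_refineRel_of_solution (fun u v => ?_) _ v v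
      have hallowed : ∀ u, Allowed τ a b u (φ u) := fun u => by
        refine ⟨?_, fun h => h ▸ ha, fun h => h ▸ hb⟩
        by_cases h : u ∈ X <;> simp [τ, h]
      exact ⟨hallowed u, hallowed v, fun h => h ▸ rfl, hφ u v⟩

/-! ### The reduction -/

/-- The inputs: connected graphs with the size of a chordal deletion. -/
structure ChordalDeletionInput where
  /-- the number of vertices -/
  n : ℕ
  /-- the graph -/
  G : SimpleGraph (Fin n)
  /-- the parameter -/
  l : ℕ
  connected : G.Connected
  exists_deletion : ∃ X : Finset (Fin n), X.card = l ∧ G.IsChordalDeletion X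

theorem mainTheorem9 (f : ℕ → NNReal) (A : Prog) (hA : A.ComputesChordalDeletion f) :
    ∃ B : Prog, B.DecidesIndependentCutset (fun l => f l + 3 ^ l) := by
  obtain ⟨C, c, hA⟩ := hA
  have hA' := fun i : ChordalDeletionInput => hA i.n i.G i.l i.connected i.exists_deletion
  choose y t hrun hgood hbound using hA'
  choose X hXl hX hyX using hgood
  let n : ChordalDeletionInput → ℕ := ChordalDeletionInput.n
  let x : ChordalDeletionInput → SExp := fun i => ofInstance i.G i.l
  -- The context of the branching algorithm: the instance, the deletion set, the number of vertices.
  let x' : ChordalDeletionInput → SExp := fun i => .cons (x i) (ofVertexSet (X i))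
  let x'' : ChordalDeletionInput → SExp := fun i => .cons (x' i) (ofNat (n i))
  have hw : ∀ i : ChordalDeletionInput, (1 : ℝ≥0) ≤ f i.l + 3 ^ i.l := fun i =>
    (one_le_pow₀ (by norm_num)).trans le_add_self
  have hy : Comp n (fun i => f i.l) x (fun i => ofVertexSet (X i)) := by
    refine ⟨A, t, fun i => by have := hrun i; rwa [hyX i] at this, C, c,
      fun i => (hbound i).trans ?_⟩
    gcongr
    exact le_self_add
  have hlen : ∀ i : ChordalDeletionInput, i.n = (List.ofFn fun v => ofProp (v ∈ X i)).length :=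
    fun i => by simp
  have hn : PolyComp n x' (fun i => ofNat (n i)) :=
    (PolyComp.length (x := x') (l := fun i => List.ofFn fun v => ofProp (v ∈ X i)) .snd
      (PolyBd.self.mono (fun i => by simp [n]) fun _ => le_rfl)).congr fun i => by
        rw [← hlen]
  have hG : PolyComp n x'' (fun i => ofGraph i.G) := .skip (.skip .fst)
  have hbranch := Comp.exists_accepts .snd hG (.branch .snd (.skip .snd) hXl)
    (fun i c hc => (mem_branch_ofFn.mp hc).1) fun i => by
      simpa [hXl] using length_branch_drop_le (X i) 0
  obtain ⟨B, T, hB, D, d, hT⟩ : Comp n (fun i => f i.l + 3 ^ i.l) x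
      (fun i => ofProp i.G.HasIndependentCutset) := by
    refine (Comp.cons (.id hw) (hy.mono fun i => le_self_add)).seq ?_
    refine (Comp.cons (.id hw) (hn.mono hw)).seq ?_
    exact (hbranch.mono fun i => le_add_self).congr fun i =>
      ofProp_congr (exists_accepts_iff (hX i))
  refine ⟨B, D * 2 ^ d, d, fun m G l hconn hdel => ?_⟩
  let i : ChordalDeletionInput := ⟨m, G, l, hconn, hdel⟩
  refine ⟨_, T i, hB i, rfl, (hT i).trans ?_⟩
  have hm : (1 : ℝ≥0) ≤ m := by
    have := hconn.nonempty
    exact_mod_cast Fin.pos_iff_nonempty.mpr this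
  calc (D : ℝ≥0) * (f l + 3 ^ l) * ((m : ℝ≥0) + 1) ^ d
      ≤ D * (f l + 3 ^ l) * ((m : ℝ≥0) + m) ^ d := by gcongr
    _ = (D * 2 ^ d : ℕ) * (f l + 3 ^ l) * (m : ℝ≥0) ^ d := by
      rw [← two_mul, mul_pow]
      push_cast
      ring
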